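/- Let $d\ge 1$ and let $f:\mathbb R^d\to\mathbb C$ belong to $H^{1/2}(\mathbb R^d)$, i.e. $f\in L^2(\mathbb R^d)$ and $\iint_{\mathbb R^d\times\mathbb R^d}\frac{|f(x)-f(y)|^2}{|x-y|^{d+1}}\,dx\,dy<\infty$. For $L>0$ let $$K_L(x,y)=2^{d/2}\,\Gamma\!\left(\tfrac d2+1\right)\frac{L^{d/2}J_{d/2}(L\pi|x-y|)}{(\pi|x-y|)^{d/2}},\qquad K_L(x,x)=L^d,$$ be the Bessel kernel, where $J_{d/2}$ is the Bessel function of the first kind, and let $$d\mu(x)=\frac{\pi^{d/2}}{2^d\,\Gamma(\frac d2+1)}\,dx$$ be Lebesgue measure, normalised so that $K_L$ is the kernel of an orthogonal projection in $L^2(\mu)$ (for $d=1$, $\mu$ is Lebesgue measure). Let $\Xi_L$ be the Bessel determinantal point process, i.e. a simple point process on $\mathbb R^d$ whose joint intensities with respect to $\mu$ are $\det(K_L(x_i,x_j))_{i,j=1}^k$ for every $k$; its intensity with respect to $\mu$ is $L^d$. Then $$\lim_{L\to\infty}\frac1{L^{d-1}}\operatorname{Var}\Bigl(\sum_{x\in\Xi_L}f(x)\Bigr)=\frac{2^{d-1}\,\Gamma\left(\frac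 d2+1\right)^2}{\pi^{d+2}}\iint_{\mathbb R^d\times\mathbb R^d}\frac{|f(x)-f(y)|^2}{|x-y|^{d+1}}\,d\mu(x)\,d\mu(y)$$ (equivalently, in terms of Lebesgue measure, the limit is $\frac{1}{2^{d+1}\pi^2}\iint\frac{|f(x)-f(y)|^2}{|x-y|^{d+1}}\,dx\,dy$). Here $\operatorname{Var}(Z)=\mathbb E|Z-\mathbb EZ|^2$. If $f$ is also integrable, then for every $L>0$ the sum converges absolutely almost surely and is square integrable. If $f$ is not integrable, the sum may fail to converge absolutely, and the centred statistic $\sum_{x\in\Xi_L}f(x)-\mathbb E\sum_{x\in\Xi_L}f(x)$ is understood as the limit in $L^2(\mathbb P)$ of the centred statistics of $g_n$, for every sequence $g_n\in L^1\cap L^2$ with $g_n\to f$ in $L^2(\mathbb R^d)$; this limit exists for every $L>0$. -/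

import Mathlib

open MeasureTheory Filter Topology

noncomputable section

namespace BesselDPP

/-- The Bessel function of the first kind `J_ν`, given by its power series (used for `ν ≥ 0` and
`z ≥ 0`). -/
def besselJ (ν z : ℝ) : ℝ :=
  ∑' m : ℕ, (-1 : ℝ) ^ m / (m.factorial * Real.Gamma (m + ν + 1)) * (z / 2) ^ (2 * (m : ℝ) + ν)

/-- The radial profile of the Bessel kernel,
`Ψ_L(r) = 2^{d/2} Γ(d/2+1) L^{d/2} J_{d/2}(L π r) / (π r)^{d/2}`, extended by continuity to
`Ψ_L(0) = L^d`. -/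
def besselProfile (d : ℕ) (L r : ℝ) : ℝ :=
  if r = 0 then L ^ d
  else (2 : ℝ) ^ ((d : ℝ) / 2) * Real.Gamma ((d : ℝ) / 2 + 1) *
    (L ^ ((d : ℝ) / 2) * besselJ ((d : ℝ) / 2) (L * Real.pi * r)) /
      (Real.pi * r) ^ ((d : ℝ) / 2)

/-- The Bessel kernel `K_L(x, y) = Ψ_L(|x - y|)` on `ℝ^d`. -/
def besselKernel (d : ℕ) (L : ℝ) (x y : EuclideanSpace ℝ (Fin d)) : ℝ :=
  besselProfile d L ‖x - y‖

/-- Lebesgue measure on `ℝ^d` multiplied by the volume `π^{d/2} / (2^d Γ(d/2+1))` of a ball of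
radius `1/2`. With respect to this measure `K_L` is the reproducing kernel of the space of `L²`
functions with spectrum in a ball, i.e. the kernel of an orthogonal projection. It is Lebesgue
measure itself if `d = 1`. -/
def besselMeasure (d : ℕ) : Measure (EuclideanSpace ℝ (Fin d)) :=
  ENNReal.ofReal (Real.pi ^ ((d : ℝ) / 2) / (2 ^ d * Real.Gamma ((d : ℝ) / 2 + 1))) • volume

section PointProcess

variable {X Ω : Type*} [PseudoMetricSpace X] [MeasurableSpace X] [MeasurableSpace Ω]

/-- A simple point process on `X`: a random locally finite subset of `X` whose counting variables
are measurable. -/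
structure IsSimplePointProcess (Ξ : Ω → Set X) : Prop where
  finite_inter : ∀ ω, ∀ B : Set X, Bornology.IsBounded B → (Ξ ω ∩ B).Finite
  measurable_count : ∀ B : Set X, MeasurableSet B → Measurable fun ω => (Ξ ω ∩ B).encard

/-- The set of `k`-tuples of pairwise distinct points of `S` that lie in `A`. -/
def distinctTuples (S : Set X) (k : ℕ) (A : Set (Fin k → X)) : Set (Fin k → X) :=
  {x | Function.Injective x ∧ (∀ i, x i ∈ S) ∧ x ∈ A}

/-- `Ξ` is a determinantal point process with kernel `K` and background measure `μ`: for every `k`,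
the `k`-th factorial moment measure of `Ξ` has the density `det (K (x_i, x_j))` with respect to
`μ^k`, i.e. the joint intensities of `Ξ` are these determinants. -/
structure IsDeterminantal (P : Measure Ω) (Ξ : Ω → Set X) (K : X → X → ℝ) (μ : Measure X) :
    Prop where
  isSimplePointProcess : IsSimplePointProcess Ξ
  jointIntensity : ∀ (k : ℕ) (A : Set (Fin k → X)), MeasurableSet A →
    ∫⁻ ω, ((distinctTuples (Ξ ω) k A).encard : ENNReal) ∂P =
      ∫⁻ x in A, ENNReal.ofReal (Matrix.of fun i j => K (x i) (x j)).det ∂(Measure.pi fun _ => μ)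

/-- The linear statistic `∑_{x ∈ Ξ} f(x)`. -/
def linearStatistic (Ξ : Ω → Set X) (f : X → ℂ) (ω : Ω) : ℂ :=
  ∑' x : Ξ ω, f x

/-- The variance `E|Z - E Z|²` of a complex random variable. -/
def complexVariance (P : Measure Ω) (Z : Ω → ℂ) : ℝ :=
  ∫ ω, ‖Z ω - ∫ ω', Z ω' ∂P‖ ^ 2 ∂P

/-- `Y` is the centred linear statistic `∑_{x ∈ Ξ} f(x) - E ∑_{x ∈ Ξ} f(x)` of a square integrable
`f`, where the sum need not converge absolutely: `Y` is the limit in `L²(P)` of the centred linear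
statistics of `g n`, for every sequence of functions `g n ∈ L¹ ∩ L²` converging to `f` in `L²`.
If `f` itself is also integrable, constant sequences give the literal meaning. -/
structure IsCenteredLinearStatistic (P : Measure Ω) (Ξ : Ω → Set X) (μ : Measure X)
    (f : X → ℂ) (Y : Ω → ℂ) : Prop where
  memLp : MemLp Y 2 P
  tendsto : ∀ g : ℕ → X → ℂ, (∀ n, MemLp (g n) 1 μ) → (∀ n, MemLp (g n) 2 μ) →
    Tendsto (fun n => eLpNorm (g n - f) 2 μ) atTop (𝓝 0) →
    Tendsto (fun n => eLpNorm
      (fun ω => linearStatistic Ξ (g n) ω - (∫ ω', linearStatistic Ξ (g n) ω' ∂P) - Y ω) 2 P)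
      atTop (𝓝 0)

end PointProcess

/-- The integrand `|f(x) - f(y)|² / |x - y|^{d+1}` of the Gagliardo seminorm of order `1/2`. -/
def gagliardoIntegrand {d : ℕ} (f : EuclideanSpace ℝ (Fin d) → ℂ)
    (p : EuclideanSpace ℝ (Fin d) × EuclideanSpace ℝ (Fin d)) : ℝ :=
  ‖f p.1 - f p.2‖ ^ 2 / ‖p.1 - p.2‖ ^ (d + 1)

/-- The Sobolev space `H^{1/2}(ℝ^d)`: square integrable functions with finite Gagliardo
seminorm. -/
def MemHHalf {d : ℕ} (f : EuclideanSpace ℝ (Fin d) → ℂ) : Prop :=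
  MemLp f 2 volume ∧ Integrable (gagliardoIntegrand f) (volume.prod volume)

/-- The limiting variance `2^{d-1} Γ(d/2+1)² / π^{d+2} ∬ |f(x) - f(y)|² / |x - y|^{d+1}`. -/
def limitVariance (d : ℕ) (f : EuclideanSpace ℝ (Fin d) → ℂ) : ℝ :=
  2 ^ (d - 1) * Real.Gamma ((d : ℝ) / 2 + 1) ^ 2 / Real.pi ^ (d + 2) *
    ∫ p, gagliardoIntegrand f p ∂((besselMeasure d).prod (besselMeasure d))

end BesselDPP

end

namespace BesselDPP

/-! The variance becomes explicit on the Fourier side. For a determinantal process with symmetric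
kernel `K`, constant on the diagonal with value `κ`, splitting pairs of points into coincident and
distinct ones gives the variance κ∫|f|² - ∬K²f(x)f̄(y)
(`IsDeterminantal.summable_and_memLp_and_complexVariance`).

With respect to Lebesgue measure the Bessel kernel is the Fourier transform of the indicator of the
ball B of radius L/2, evaluated at x - y (`setIntegral_ball_cos`). Plancherel and Fubini then turn
the variance into ∫|f̂(w)|² |B \ (w + B)| dw (`ballKernel_variance_eq`).

Write d = n + 1. Slicing parallel to w shows that |B \ (w + B)| is at most |w| times the volume of
the n-dimensional disc of radius L/2, and is asymptotic to this bound as L → ∞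
(`volume_ball_diff_ball_le`, `tendsto_volume_ball_diff_ball`). After division by L^n the integrands
are therefore dominated by their limit, a multiple of |w||f̂(w)|². The integral of that limit is a
multiple of the Gagliardo seminorm (`lintegral_gagliardoIntegrand`), finite exactly because f is in
H^{1/2}; dominated convergence concludes (`tendsto_div_pow_limitVariance`).

If f is only in L², the bound |B \ (w + B)| ≤ |B| makes the centred statistic Lipschitz in the L²
norm of the function. It therefore extends to all of L², and the Fourier formula for the variance
extends with it. -/

/-! ### Volume of a ball minus its translate. -/

/-- The point of `ℝ^{n+1}` with first coordinate `t` and remaining coordinates `y`. -/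
def euclideanCons {n : ℕ} (t : ℝ) (y : EuclideanSpace ℝ (Fin n)) :
    EuclideanSpace ℝ (Fin (n + 1)) :=
  WithLp.toLp 2 (Fin.cons t y.ofLp : Fin (n + 1) → ℝ)

theorem euclideanCons_zero {n : ℕ} (t : ℝ) (y : EuclideanSpace ℝ (Fin n)) :
    euclideanCons t y 0 = t := rfl

theorem norm_euclideanCons_sq {n : ℕ} (t : ℝ) (y : EuclideanSpace ℝ (Fin n)) :
    ‖euclideanCons t y‖ ^ 2 = t ^ 2 + ‖y‖ ^ 2 := by
  rw [EuclideanSpace.norm_sq_eq, EuclideanSpace.norm_sq_eq, Fin.sum_univ_succ]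
  simp [euclideanCons]

theorem norm_euclideanCons_sub_single_sq {n : ℕ} (t s : ℝ) (y : EuclideanSpace ℝ (Fin n)) :
    ‖euclideanCons t y - EuclideanSpace.single 0 s‖ ^ 2 = (t - s) ^ 2 + ‖y‖ ^ 2 := by
  rw [EuclideanSpace.norm_sq_eq, EuclideanSpace.norm_sq_eq, Fin.sum_univ_succ]
  simp [euclideanCons]

theorem measurePreserving_euclideanCons (n : ℕ) :
    MeasurePreserving (fun p : ℝ × EuclideanSpace ℝ (Fin n) => euclideanCons p.1 p.2) := by
  have h1 := PiLp.volume_preserving_toLp (Fin (n + 1))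
  have h2 := (volume_preserving_piFinSuccAbove (fun _ : Fin (n + 1) => ℝ) 0).symm
  have h3 : MeasurePreserving (Prod.map id WithLp.ofLp :
      ℝ × EuclideanSpace ℝ (Fin n) → ℝ × (Fin n → ℝ)) :=
    (MeasurePreserving.id _).prod (PiLp.volume_preserving_ofLp (Fin n))
  have h := h1.comp (h2.comp h3)
  convert h using 1
  ext p i
  refine Fin.cases ?_ (fun j => ?_) i <;>
    simp [euclideanCons, MeasurableEquiv.piFinSuccAbove, Fin.insertNthEquiv]

theorem lintegral_euclideanSpace_succ {n : ℕ} {F : EuclideanSpace ℝ (Fin (n + 1)) → ENNReal}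
    (hF : Measurable F) :
    ∫⁻ x, F x = ∫⁻ y : EuclideanSpace ℝ (Fin n), ∫⁻ t : ℝ, F (euclideanCons t y) := by
  rw [← (measurePreserving_euclideanCons n).lintegral_comp hF, Measure.volume_eq_prod,
    lintegral_prod_symm]
  exact (hF.comp (measurePreserving_euclideanCons n).measurable).aemeasurable

/-- Two vectors of equal norm are swapped by the reflection in the hyperplane that bisects them. -/
theorem exists_linearIsometryEquiv_single {n : ℕ} (z : EuclideanSpace ℝ (Fin (n + 1))) :
    ∃ T : EuclideanSpace ℝ (Fin (n + 1)) ≃ₗᵢ[ℝ] EuclideanSpace ℝ (Fin (n + 1)),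
      T z = EuclideanSpace.single 0 ‖z‖ :=
  ⟨_, Submodule.reflection_sub (v := z) (w := EuclideanSpace.single 0 ‖z‖) (by simp)⟩

theorem volume_ball_diff_ball_eq_single {n : ℕ} (R : ℝ) (z : EuclideanSpace ℝ (Fin (n + 1))) :
    volume (Metric.ball 0 R \ Metric.ball z R) =
      volume (Metric.ball (0 : EuclideanSpace ℝ (Fin (n + 1))) R \
        Metric.ball (EuclideanSpace.single 0 ‖z‖) R) := by
  obtain ⟨T, hT⟩ := exists_linearIsometryEquiv_single z
  symm
  rw [← hT, ← T.measurePreserving.measure_preimage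
    (measurableSet_ball.diff measurableSet_ball).nullMeasurableSet, Set.preimage_sdiff]
  congr 2
  · ext x; simp
  · ext x; simp

/-- Fubini along the lines parallel to the translation: on the line over `y` both balls cut out
intervals of the same length, shifted by `s`. -/
theorem volume_ball_diff_ball_single {n : ℕ} {R : ℝ} (hR : 0 < R) (s : ℝ) :
    volume (Metric.ball (0 : EuclideanSpace ℝ (Fin (n + 1))) R \
        Metric.ball (EuclideanSpace.single 0 s) R) =
      ∫⁻ y : EuclideanSpace ℝ (Fin n),
        volume {t : ℝ | t ^ 2 + ‖y‖ ^ 2 < R ^ 2 ∧ R ^ 2 ≤ (t - s) ^ 2 + ‖y‖ ^ 2} := by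
  rw [← lintegral_indicator_one (measurableSet_ball.diff measurableSet_ball),
    lintegral_euclideanSpace_succ
      (measurable_one.indicator (measurableSet_ball.diff measurableSet_ball))]
  refine lintegral_congr fun y => ?_
  have hm : MeasurableSet
      {t : ℝ | t ^ 2 + ‖y‖ ^ 2 < R ^ 2 ∧ R ^ 2 ≤ (t - s) ^ 2 + ‖y‖ ^ 2} := by
    rw [Set.ofPred_and]
    exact (measurableSet_lt (by fun_prop) (by fun_prop)).inter
      (measurableSet_le (by fun_prop) (by fun_prop))
  rw [← lintegral_indicator_one hm]
  refine lintegral_congr fun t => ?_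
  have key : euclideanCons t y ∈ Metric.ball (0 : EuclideanSpace ℝ (Fin (n + 1))) R \
        Metric.ball (EuclideanSpace.single 0 s) R ↔
      t ∈ {t : ℝ | t ^ 2 + ‖y‖ ^ 2 < R ^ 2 ∧ R ^ 2 ≤ (t - s) ^ 2 + ‖y‖ ^ 2} := by
    rw [Set.mem_sdiff, mem_ball_zero_iff, Metric.mem_ball, dist_eq_norm, not_lt,
      ← sq_lt_sq₀ (norm_nonneg _) hR.le, ← sq_le_sq₀ hR.le (norm_nonneg _),
      norm_euclideanCons_sq, norm_euclideanCons_sub_single_sq]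
    rfl
  by_cases h : euclideanCons t y ∈ Metric.ball (0 : EuclideanSpace ℝ (Fin (n + 1))) R \
        Metric.ball (EuclideanSpace.single 0 s) R
  · rw [Set.indicator_of_mem h, Set.indicator_of_mem (key.1 h)]; rfl
  · rw [Set.indicator_of_notMem h, Set.indicator_of_notMem (fun h' => h (key.2 h'))]

/-- A ball minus its translate by `z` has volume at most `‖z‖` times that of an equatorial disc. -/
theorem volume_ball_diff_ball_le {n : ℕ} {R : ℝ} (hR : 0 < R)
    (z : EuclideanSpace ℝ (Fin (n + 1))) :
    volume (Metric.ball 0 R \ Metric.ball z R) ≤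
      ENNReal.ofReal ‖z‖ * volume (Metric.ball (0 : EuclideanSpace ℝ (Fin n)) R) := by
  rw [volume_ball_diff_ball_eq_single, volume_ball_diff_ball_single hR]
  set s := ‖z‖
  have hs : 0 ≤ s := norm_nonneg _
  calc _ ≤ ∫⁻ y : EuclideanSpace ℝ (Fin n),
        (Metric.ball (0 : EuclideanSpace ℝ (Fin n)) R).indicator (fun _ => ENNReal.ofReal s) y := by
        refine lintegral_mono fun y => ?_
        by_cases hy : y ∈ Metric.ball (0 : EuclideanSpace ℝ (Fin n)) R
        · rw [Set.indicator_of_mem hy]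
          rw [mem_ball_zero_iff] at hy
          have ha : 0 ≤ R ^ 2 - ‖y‖ ^ 2 := by nlinarith [norm_nonneg y]
          set a := √(R ^ 2 - ‖y‖ ^ 2)
          have haa : a ^ 2 = R ^ 2 - ‖y‖ ^ 2 := Real.sq_sqrt ha
          have ha0 : 0 ≤ a := Real.sqrt_nonneg _
          -- The line over `y` meets the ball in (-a, a) and its translate in (s - a, s + a); what
          -- is left over lies to the left of the second interval.
          calc _ ≤ volume (Set.Ioc (-a) (s - a)) := by
                refine measure_mono fun t ht => ?_
                obtain ⟨h1, h2⟩ := ht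
                have h3 : t ^ 2 < a ^ 2 := by linarith
                have h4 : a ^ 2 ≤ (t - s) ^ 2 := by linarith
                have h5 := abs_lt_of_sq_lt_sq' h3 ha0
                refine ⟨h5.1, ?_⟩
                have h6 : a ≤ |t - s| := by rwa [← abs_of_nonneg ha0, ← sq_le_sq]
                rcases le_abs.1 h6 with h7 | h7 <;> linarith
            _ = _ := by rw [Real.volume_Ioc]; congr 1; ring
        · rw [Set.indicator_of_notMem hy, nonpos_iff_eq_zero]
          convert measure_empty (μ := (volume : Measure ℝ))
          ext t
          rw [mem_ball_zero_iff, not_lt] at hy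
          simp only [Set.mem_ofPred_eq, Set.mem_empty_iff_false, iff_false, not_and]
          intro h
          nlinarith [norm_nonneg y, sq_nonneg t]
    _ = _ := by
        rw [lintegral_indicator_const measurableSet_ball]

/-- Over the smaller disc the half-chord `a` exceeds `s / 2`, so the shifted chord still overlaps
the original one and the slice has full length `s`. -/
theorem le_volume_ball_diff_ball {n : ℕ} {R : ℝ} (hR : 0 < R)
    (z : EuclideanSpace ℝ (Fin (n + 1))) :
    ENNReal.ofReal ‖z‖ * volume (Metric.ball (0 : EuclideanSpace ℝ (Fin n))
      √(R ^ 2 - (‖z‖ / 2) ^ 2)) ≤ volume (Metric.ball 0 R \ Metric.ball z R) := by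
  rw [volume_ball_diff_ball_eq_single, volume_ball_diff_ball_single hR]
  set s := ‖z‖
  have hs : 0 ≤ s := norm_nonneg _
  set b := √(R ^ 2 - (s / 2) ^ 2) with hb
  rw [← lintegral_indicator_const measurableSet_ball]
  refine lintegral_mono fun y => ?_
  by_cases hy : y ∈ Metric.ball (0 : EuclideanSpace ℝ (Fin n)) b
  · rw [Set.indicator_of_mem hy]
    rw [mem_ball_zero_iff, hb, Real.lt_sqrt (norm_nonneg _)] at hy
    have ha : 0 ≤ R ^ 2 - ‖y‖ ^ 2 := by nlinarith
    set a := √(R ^ 2 - ‖y‖ ^ 2)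
    have haa : a ^ 2 = R ^ 2 - ‖y‖ ^ 2 := Real.sq_sqrt ha
    have ha0 : 0 ≤ a := Real.sqrt_nonneg _
    have hsa : s / 2 < a := lt_of_pow_lt_pow_left₀ 2 ha0 (by linarith)
    calc ENNReal.ofReal s = volume (Set.Ioo (-a) (s - a)) := by
          rw [Real.volume_Ioo]; congr 1; ring
      _ ≤ _ := by
          refine measure_mono fun t ht => ?_
          obtain ⟨h1, h2⟩ := ht
          constructor <;> nlinarith
  · rw [Set.indicator_of_notMem hy]; exact bot_le

theorem volume_ball_euclideanSpace_eq_pow {n : ℕ} {r : ℝ} (hr : 0 < r) :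
    volume (Metric.ball (0 : EuclideanSpace ℝ (Fin n)) r) =
      ENNReal.ofReal (r ^ n) * volume (Metric.ball (0 : EuclideanSpace ℝ (Fin n)) 1) := by
  rw [Measure.addHaar_ball_of_pos _ _ hr, finrank_euclideanSpace_fin]

/-- A squeeze: once `R ^ n` is factored out, the upper and lower bounds differ only by the factor (1
- (‖z‖/2R)²)^{n/2}, which tends to 1. -/
theorem tendsto_volume_ball_diff_ball {n : ℕ} (z : EuclideanSpace ℝ (Fin (n + 1))) :
    Tendsto (fun R : ℝ => ENNReal.ofReal ((R ^ n)⁻¹) *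
      volume (Metric.ball 0 R \ Metric.ball z R)) atTop
      (𝓝 (ENNReal.ofReal ‖z‖ * volume (Metric.ball (0 : EuclideanSpace ℝ (Fin n)) 1))) := by
  have hfin : volume (Metric.ball (0 : EuclideanSpace ℝ (Fin n)) 1) ≠ ⊤ := measure_ball_lt_top.ne
  refine tendsto_of_tendsto_of_tendsto_of_le_of_le'
    (g := fun R : ℝ => ENNReal.ofReal ‖z‖ * (ENNReal.ofReal (√(1 - (‖z‖ / 2 / R) ^ 2) ^ n) *
      volume (Metric.ball (0 : EuclideanSpace ℝ (Fin n)) 1))) ?_ tendsto_const_nhds ?_ ?_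
  · have h1 : Tendsto (fun R : ℝ => √(1 - (‖z‖ / 2 / R) ^ 2) ^ n) atTop (𝓝 1) := by
      have : Tendsto (fun R : ℝ => √(1 - (‖z‖ / 2 / R) ^ 2) ^ n) atTop
          (𝓝 (√(1 - 0 ^ 2) ^ n)) :=
        ((((tendsto_const_nhds.div_atTop tendsto_id).pow 2).const_sub 1).sqrt).pow n
      simpa using this
    have h2 := ENNReal.tendsto_ofReal h1
    have h3 := ENNReal.Tendsto.mul_const
      (b := volume (Metric.ball (0 : EuclideanSpace ℝ (Fin n)) 1))
      h2 (Or.inr hfin)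
    have h4 := ENNReal.Tendsto.const_mul (a := ENNReal.ofReal ‖z‖) h3
      (Or.inr ENNReal.ofReal_ne_top)
    simpa using h4
  · filter_upwards [eventually_gt_atTop 0, eventually_gt_atTop (‖z‖ / 2)] with R hR hRz
    have h := le_volume_ball_diff_ball hR z
    rw [volume_ball_euclideanSpace_eq_pow
      (Real.sqrt_pos.2 (sub_pos.2 (pow_lt_pow_left₀ hRz (by positivity) two_ne_zero)))] at h
    calc _ = ENNReal.ofReal ((R ^ n)⁻¹) * (ENNReal.ofReal ‖z‖ *
          (ENNReal.ofReal (√(R ^ 2 - (‖z‖ / 2) ^ 2) ^ n) *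
          volume (Metric.ball (0 : EuclideanSpace ℝ (Fin n)) 1))) := by
          have : √(R ^ 2 - (‖z‖ / 2) ^ 2) = R * √(1 - (‖z‖ / 2 / R) ^ 2) := by
            rw [← Real.sqrt_sq hR.le, ← Real.sqrt_mul (sq_nonneg R), Real.sqrt_sq hR.le]
            congr 1; field_simp
          rw [this, mul_pow, ENNReal.ofReal_mul (by positivity), ENNReal.ofReal_inv_of_pos
            (by positivity)]
          have h0 : ENNReal.ofReal (R ^ n) ≠ 0 := by
            rw [Ne, ENNReal.ofReal_eq_zero, not_le]; positivity
          rw [mul_assoc (ENNReal.ofReal (R ^ n)),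
            mul_left_comm (ENNReal.ofReal ‖z‖) (ENNReal.ofReal (R ^ n)),
            ← mul_assoc _ (ENNReal.ofReal (R ^ n)),
            ENNReal.inv_mul_cancel h0 ENNReal.ofReal_ne_top, one_mul]
      _ ≤ _ := by gcongr
  · filter_upwards [eventually_gt_atTop 0] with R hR
    have h := volume_ball_diff_ball_le hR z
    rw [volume_ball_euclideanSpace_eq_pow hR] at h
    have h0 : ENNReal.ofReal (R ^ n) ≠ 0 := by
      rw [Ne, ENNReal.ofReal_eq_zero, not_le]; positivity
    refine (mul_le_mul_right h _).trans_eq ?_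
    rw [ENNReal.ofReal_inv_of_pos (by positivity),
      mul_left_comm (ENNReal.ofReal ‖z‖), ← mul_assoc _ (ENNReal.ofReal (R ^ n)),
      ENNReal.inv_mul_cancel h0 ENNReal.ofReal_ne_top, one_mul]

/-! ### The Bessel kernel as the Fourier transform of a ball. -/

/-- The duplication formula at `m + 1/2`. The factorial `(2m)!` produced here will cancel the one in
the cosine series. -/
theorem Gamma_nat_add_half_eq (m : ℕ) :
    Real.Gamma (m + 1 / 2) = (2 * m).factorial * √Real.pi / (4 ^ m * m.factorial) := by
  have h := Real.Gamma_mul_Gamma_add_half (m + 1 / 2)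
  rw [show (m : ℝ) + 1 / 2 + 1 / 2 = m + 1 by ring, Real.Gamma_nat_eq_factorial,
    show 2 * ((m : ℝ) + 1 / 2) = ((2 * m : ℕ) : ℝ) + 1 by push_cast; ring,
    Real.Gamma_nat_eq_factorial,
    show (1 : ℝ) - (((2 * m : ℕ) : ℝ) + 1) = -((2 * m : ℕ) : ℝ) by ring,
    Real.rpow_neg (by norm_num), Real.rpow_natCast, pow_mul] at h
  norm_num at h ⊢
  field_simp at h ⊢
  linarith

theorem lintegral_pow_mul_exp_neg_sq (m : ℕ) :
    ∫⁻ t : ℝ, ENNReal.ofReal (t ^ (2 * m) * Real.exp (-t ^ 2)) =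
      ENNReal.ofReal (Real.Gamma (m + 1 / 2)) := by
  have hint : Integrable fun t : ℝ => t ^ (2 * m) * Real.exp (-t ^ 2) := by
    have := integrable_rpow_mul_exp_neg_mul_sq (b := 1) one_pos (s := ((2 * m : ℕ) : ℝ))
      (by have : (0 : ℝ) ≤ ((2 * m : ℕ) : ℝ) := Nat.cast_nonneg _
          linarith)
    simpa only [Real.rpow_natCast, neg_mul, one_mul] using this
  rw [← ofReal_integral_eq_lintegral_ofReal hint
    (Eventually.of_forall fun t => by have := (even_two_mul m).pow_nonneg t; positivity)]
  congr 1
  have h1 := integral_comp_abs (f := fun t : ℝ => t ^ (2 * m) * Real.exp (-t ^ 2))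
  simp only [(even_two_mul m).pow_abs, sq_abs] at h1
  have h2 := integral_rpow_mul_exp_neg_rpow (p := 2) two_pos (q := ((2 * m : ℕ) : ℝ))
      (by have : (0 : ℝ) ≤ ((2 * m : ℕ) : ℝ) := Nat.cast_nonneg _
          linarith)
  simp only [Real.rpow_natCast, Real.rpow_two] at h2
  rw [h1, h2]
  push_cast
  rw [show (2 * (m : ℝ) + 1) / 2 = m + 1 / 2 by ring]
  ring

theorem lintegral_exp_neg_norm_sq (n : ℕ) :
    ∫⁻ y : EuclideanSpace ℝ (Fin n), ENNReal.ofReal (Real.exp (-‖y‖ ^ 2)) =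
      ENNReal.ofReal (Real.pi ^ ((n : ℝ) / 2)) := by
  have h := GaussianFourier.integral_rexp_neg_mul_sq_norm (V := EuclideanSpace ℝ (Fin n))
    (b := 1) one_pos
  have hpos : (0 : ℝ) < Real.pi ^ ((n : ℝ) / 2) := by positivity
  simp only [neg_mul, one_mul, div_one, finrank_euclideanSpace_fin] at h
  rw [← ofReal_integral_eq_lintegral_ofReal _ (Eventually.of_forall fun t => by positivity), h]
  -- Integrability comes for free: the integral of a non-integrable function is 0 by convention,
  -- while the Gaussian integral is positive.
  by_contra hi
  rw [integral_undef hi] at h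
  exact hpos.ne h

/-- Rotating `z` onto the first axis makes the integrand a product of a one-dimensional moment and a
Gaussian in the other `n` variables. -/
theorem lintegral_inner_pow_mul_exp_neg_norm_sq {n : ℕ} (z : EuclideanSpace ℝ (Fin (n + 1)))
    (m : ℕ) :
    ∫⁻ x : EuclideanSpace ℝ (Fin (n + 1)),
        ENNReal.ofReal (inner ℝ z x ^ (2 * m) * Real.exp (-‖x‖ ^ 2)) =
      ENNReal.ofReal (‖z‖ ^ (2 * m) * Real.Gamma (m + 1 / 2) * Real.pi ^ ((n : ℝ) / 2)) := by
  obtain ⟨T, hT⟩ := exists_linearIsometryEquiv_single z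
  have h1 : ∀ x : EuclideanSpace ℝ (Fin (n + 1)),
      ENNReal.ofReal (inner ℝ z x ^ (2 * m) * Real.exp (-‖x‖ ^ 2)) =
      (fun w : EuclideanSpace ℝ (Fin (n + 1)) =>
        ENNReal.ofReal ((‖z‖ * w 0) ^ (2 * m) * Real.exp (-‖w‖ ^ 2))) (T x) := by
    intro x
    have : inner ℝ z x = ‖z‖ * (T x) 0 := by
      rw [← T.inner_map_map z x, hT, EuclideanSpace.inner_single_left]; simp
    simp only [this, T.norm_map]
  simp_rw [h1]
  have hmeas : Measurable fun w : EuclideanSpace ℝ (Fin (n + 1)) =>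
        ENNReal.ofReal ((‖z‖ * w 0) ^ (2 * m) * Real.exp (-‖w‖ ^ 2)) := by fun_prop
  rw [T.measurePreserving.lintegral_comp hmeas, lintegral_euclideanSpace_succ hmeas]
  have h2 : ∀ (y : EuclideanSpace ℝ (Fin n)) (t : ℝ),
      ENNReal.ofReal ((‖z‖ * euclideanCons t y 0) ^ (2 * m) * Real.exp (-‖euclideanCons t y‖ ^ 2))
      = ENNReal.ofReal (‖z‖ ^ (2 * m)) * ENNReal.ofReal (Real.exp (-‖y‖ ^ 2)) *
        ENNReal.ofReal (t ^ (2 * m) * Real.exp (-t ^ 2)) := by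
    intro y t
    rw [norm_euclideanCons_sq, euclideanCons_zero, ← ENNReal.ofReal_mul (by positivity),
      ← ENNReal.ofReal_mul (by positivity), neg_add, Real.exp_add, mul_pow]
    congr 1; ring
  simp_rw [h2]
  simp_rw [lintegral_const_mul' _ _ (ENNReal.mul_ne_top ENNReal.ofReal_ne_top
    ENNReal.ofReal_ne_top), lintegral_pow_mul_exp_neg_sq]
  rw [lintegral_mul_const' _ _ ENNReal.ofReal_ne_top,
    lintegral_const_mul' _ _ ENNReal.ofReal_ne_top,
    lintegral_exp_neg_norm_sq, ENNReal.ofReal_mul, ENNReal.ofReal_mul]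
  · ring
  · positivity
  · have : 0 < Real.Gamma ((m : ℝ) + 1 / 2) := Real.Gamma_pos_of_pos (by positivity)
    positivity

theorem setIntegral_ball_inner_pow_eq {d : ℕ} (z : EuclideanSpace ℝ (Fin d)) (m : ℕ) {R : ℝ}
    (hR : 0 < R) :
    ∫ x in Metric.ball (0 : EuclideanSpace ℝ (Fin d)) R, inner ℝ z x ^ (2 * m) =
      R ^ (2 * m + d) * ∫ x in Metric.ball (0 : EuclideanSpace ℝ (Fin d)) 1,
        inner ℝ z x ^ (2 * m) := by
  have h := Measure.setIntegral_comp_smul_of_pos (volume : Measure (EuclideanSpace ℝ (Fin d)))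
    (fun x => inner ℝ z x ^ (2 * m)) (Metric.ball 0 1) hR
  rw [smul_unitBall_of_pos hR, finrank_euclideanSpace_fin] at h
  simp only [inner_smul_right, mul_pow, integral_const_mul, smul_eq_mul] at h
  rw [pow_add, mul_assoc, mul_comm (R ^ d), ← mul_assoc, h]
  field_simp

theorem integrableOn_ball_of_continuous {d : ℕ} {F : Type*} [NormedAddCommGroup F]
    {g : EuclideanSpace ℝ (Fin d) → F}
    (hg : Continuous g) (x : EuclideanSpace ℝ (Fin d)) (R : ℝ) : IntegrableOn g (Metric.ball x R) :=
  (hg.continuousOn.integrableOn_compact (isCompact_closedBall x R)).mono_set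
    Metric.ball_subset_closedBall

theorem lintegral_Ioi_exp_neg (c : ℝ) :
    ∫⁻ t in Set.Ioi c, ENNReal.ofReal (Real.exp (-t)) = ENNReal.ofReal (Real.exp (-c)) := by
  rw [← ofReal_integral_eq_lintegral_ofReal (integrableOn_exp_neg_Ioi c)
    (Eventually.of_forall fun t => (Real.exp_pos _).le), integral_exp_neg_Ioi]

/-- The moments of a ball, computed from Gaussian moments by the layer cake formula. -/
theorem setIntegral_ball_inner_pow {n : ℕ} (z : EuclideanSpace ℝ (Fin (n + 1))) (m : ℕ) {R : ℝ}
    (hR : 0 < R) :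
    ∫ x in Metric.ball (0 : EuclideanSpace ℝ (Fin (n + 1))) R, inner ℝ z x ^ (2 * m) =
      R ^ (2 * m + (n + 1)) * (‖z‖ ^ (2 * m) * Real.Gamma (m + 1 / 2) * Real.pi ^ ((n : ℝ) / 2) /
        Real.Gamma (m + ((n : ℝ) + 1) / 2 + 1)) := by
  rw [setIntegral_ball_inner_pow_eq z m hR]
  congr 1
  set M := ∫ x in Metric.ball (0 : EuclideanSpace ℝ (Fin (n + 1))) 1, inner ℝ z x ^ (2 * m)
    with hM
  have hpow : ∀ x : EuclideanSpace ℝ (Fin (n + 1)), 0 ≤ inner ℝ z x ^ (2 * m) :=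
    fun x => (even_two_mul m).pow_nonneg _
  have hM0 : 0 ≤ M := integral_nonneg hpow
  set s : ℝ := m + ((n : ℝ) + 1) / 2 + 1 with hs
  have hs0 : 0 < s := by positivity
  have hG : 0 < Real.Gamma s := Real.Gamma_pos_of_pos hs0
  have hG' : 0 < Real.Gamma ((m : ℝ) + 1 / 2) := Real.Gamma_pos_of_pos (by positivity)
  rw [eq_div_iff hG.ne', ← ENNReal.ofReal_eq_ofReal_iff (by positivity) (by positivity),
    ← lintegral_inner_pow_mul_exp_neg_norm_sq]
  have hball : ∀ t : ℝ, 0 < t → ∫⁻ x : EuclideanSpace ℝ (Fin (n + 1)) in Metric.ball 0 (√t),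
      ENNReal.ofReal (inner ℝ z x ^ (2 * m)) = ENNReal.ofReal (t ^ (s - 1) * M) := by
    intro t ht
    rw [← ofReal_integral_eq_lintegral_ofReal
      (integrableOn_ball_of_continuous (by fun_prop) _ _) (Eventually.of_forall hpow),
      setIntegral_ball_inner_pow_eq z m (Real.sqrt_pos.2 ht)]
    congr 2
    rw [Real.sqrt_eq_rpow, ← Real.rpow_natCast, ← Real.rpow_mul ht.le]
    congr 1
    rw [hs]; push_cast; ring
  symm
  -- Writing e^{-‖x‖²} as the integral of e^{-t} over t > ‖x‖² and exchanging the integrals averages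
  -- the moments of the balls of radius √t. These are `M * t ^ (s - 1)` by homogeneity, `s - 1`
  -- being half the degree `2m + n + 1`, so the Gaussian moment is `M * Γ(s)`.
  calc _ = ∫⁻ x : EuclideanSpace ℝ (Fin (n + 1)), ∫⁻ t : ℝ,
        (Set.Ioi (‖x‖ ^ 2)).indicator (fun t => ENNReal.ofReal (inner ℝ z x ^ (2 * m)) *
          ENNReal.ofReal (Real.exp (-t))) t := by
        refine lintegral_congr fun x => ?_
        rw [lintegral_indicator measurableSet_Ioi, lintegral_const_mul' _ _ ENNReal.ofReal_ne_top,
          lintegral_Ioi_exp_neg, ENNReal.ofReal_mul (hpow x)]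
    _ = ∫⁻ t : ℝ, ∫⁻ x : EuclideanSpace ℝ (Fin (n + 1)),
        (Set.Ioi (‖x‖ ^ 2)).indicator (fun t => ENNReal.ofReal (inner ℝ z x ^ (2 * m)) *
          ENNReal.ofReal (Real.exp (-t))) t := by
        refine lintegral_lintegral_swap (Measurable.aemeasurable ?_)
        have hset : MeasurableSet {p : EuclideanSpace ℝ (Fin (n + 1)) × ℝ | ‖p.1‖ ^ 2 < p.2} :=
          measurableSet_lt (by fun_prop) (by fun_prop)
        have : Measurable ({p : EuclideanSpace ℝ (Fin (n + 1)) × ℝ | ‖p.1‖ ^ 2 < p.2}.indicator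
          fun p => ENNReal.ofReal (inner ℝ z p.1 ^ (2 * m)) * ENNReal.ofReal (Real.exp (-p.2))) :=
          Measurable.indicator (by fun_prop) hset
        convert this using 1
        ext ⟨x, t⟩
        simp [Set.indicator_apply]
    _ = ∫⁻ t : ℝ, (Set.Ioi (0 : ℝ)).indicator (fun t => ENNReal.ofReal M *
          ENNReal.ofReal (Real.exp (-t) * t ^ (s - 1))) t := by
        refine lintegral_congr fun t => ?_
        by_cases ht : 0 < t
        · rw [Set.indicator_of_mem (Set.mem_Ioi.2 ht), ENNReal.ofReal_mul (Real.exp_pos _).le,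
            mul_left_comm, ← ENNReal.ofReal_mul hM0, mul_comm M, ← hball t ht,
            ← lintegral_const_mul' _ _ ENNReal.ofReal_ne_top,
            ← lintegral_indicator measurableSet_ball]
          refine lintegral_congr fun x => ?_
          have hiff : x ∈ Metric.ball (0 : EuclideanSpace ℝ (Fin (n + 1))) (√t) ↔
              t ∈ Set.Ioi (‖x‖ ^ 2) := by
            rw [mem_ball_zero_iff, Real.lt_sqrt (norm_nonneg _), Set.mem_Ioi]
          by_cases hx : t ∈ Set.Ioi (‖x‖ ^ 2)
          · rw [Set.indicator_of_mem hx, Set.indicator_of_mem (hiff.2 hx), mul_comm]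
          · rw [Set.indicator_of_notMem hx, Set.indicator_of_notMem (fun h => hx (hiff.1 h))]
        · rw [Set.indicator_of_notMem (by simpa using ht)]
          refine (lintegral_congr fun x => ?_).trans lintegral_zero
          refine Set.indicator_of_notMem ?_ _
          rw [Set.mem_Ioi]
          intro h; exact ht ((sq_nonneg _).trans_lt h)
    _ = _ := by
        rw [lintegral_indicator measurableSet_Ioi, lintegral_const_mul' _ _ ENNReal.ofReal_ne_top,
          ← ofReal_integral_eq_lintegral_ofReal (Real.GammaIntegral_convergent hs0),
          ← Real.Gamma_eq_integral hs0, ENNReal.ofReal_mul hM0]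
        filter_upwards [self_mem_ae_restrict measurableSet_Ioi] with t ht
        have : (0 : ℝ) < t := ht
        positivity

/-- The cosine series is integrated term by term, which its absolute convergence, uniform on the
ball, permits. The moments of the ball convert the coefficients 1/(2m)! into those of a Bessel
series. -/
theorem setIntegral_ball_cos_eq_tsum {n : ℕ} (z : EuclideanSpace ℝ (Fin (n + 1))) {R : ℝ}
    (hR : 0 < R) :
    ∫ x in Metric.ball (0 : EuclideanSpace ℝ (Fin (n + 1))) R,
        Real.cos (2 * Real.pi * inner ℝ z x) =
      ∑' m : ℕ, (-1) ^ m * (Real.pi * ‖z‖) ^ (2 * m) * R ^ (2 * m + (n + 1)) *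
        Real.pi ^ (((n : ℝ) + 1) / 2) /
        (m.factorial * Real.Gamma (m + ((n : ℝ) + 1) / 2 + 1)) := by
  set B := Metric.ball (0 : EuclideanSpace ℝ (Fin (n + 1))) R
  let F : ℕ → EuclideanSpace ℝ (Fin (n + 1)) → ℝ := fun m x =>
    (-1) ^ m * (2 * Real.pi * inner ℝ z x) ^ (2 * m) / (2 * m).factorial
  have hFint : ∀ m, Integrable (F m) (volume.restrict B) := fun m =>
    integrableOn_ball_of_continuous (by fun_prop) _ _
  have hbound : ∀ m, ∀ x ∈ B,
      ‖F m x‖ ≤ (2 * Real.pi * (‖z‖ * R)) ^ (2 * m) / (2 * m).factorial := by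
    intro m x hx
    have hx' : ‖x‖ ≤ R := (mem_ball_zero_iff.1 hx).le
    simp only [F, norm_div, norm_mul, norm_pow, norm_neg, norm_one, one_pow, one_mul,
      Real.norm_natCast]
    gcongr
    · simp
    · exact (Real.norm_of_nonneg Real.pi_pos.le).le
    exact (norm_inner_le_norm _ _).trans (by gcongr)
  have hsum : Summable fun m => ∫ x in B, ‖F m x‖ := by
    have h0 : Summable fun m : ℕ => (2 * Real.pi * (‖z‖ * R)) ^ (2 * m) / (2 * m).factorial :=
      (Real.summable_pow_div_factorial (2 * Real.pi * (‖z‖ * R))).comp_injective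
        (mul_right_injective₀ (two_ne_zero (α := ℕ)))
    refine Summable.of_nonneg_of_le (fun m => integral_nonneg fun x => norm_nonneg _) (fun m => ?_)
      (h0.mul_right (volume.real B))
    calc _ ≤ ∫ x in B, (2 * Real.pi * (‖z‖ * R)) ^ (2 * m) / (2 * m).factorial :=
          setIntegral_mono_on (hFint m).norm (integrableOn_const measure_ball_lt_top.ne)
            measurableSet_ball (hbound m)
      _ = _ := by rw [setIntegral_const, smul_eq_mul, mul_comm]
  have h := hasSum_integral_of_summable_integral_norm hFint hsum
  have hcos : ∀ x, ∑' m, F m x = Real.cos (2 * Real.pi * inner ℝ z x) := fun x =>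
    (Real.hasSum_cos _).tsum_eq
  simp only [hcos] at h
  rw [← h.tsum_eq]
  refine tsum_congr fun m => ?_
  have hG : 0 < Real.Gamma (m + ((n : ℝ) + 1) / 2 + 1) := Real.Gamma_pos_of_pos (by positivity)
  have h1 : ∀ x, F m x = ((-1) ^ m * (2 * Real.pi) ^ (2 * m) / (2 * m).factorial) *
      inner ℝ z x ^ (2 * m) := fun x => by simp only [F]; rw [mul_pow]; ring
  simp only [h1]
  rw [integral_const_mul, setIntegral_ball_inner_pow z m hR, Gamma_nat_add_half_eq,
    show ((n : ℝ) + 1) / 2 = n / 2 + 1 / 2 by ring, Real.rpow_add Real.pi_pos,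
    ← Real.sqrt_eq_rpow]
  rw [show (n : ℝ) / 2 + 1 / 2 = ((n : ℝ) + 1) / 2 by ring]
  have h4 : (4 : ℝ) ^ m = 2 ^ (2 * m) := by rw [pow_mul]; norm_num
  rw [h4, mul_pow, mul_pow]
  field_simp

/-- The Bessel kernel is the Fourier transform of the indicator of a ball. -/
theorem setIntegral_ball_cos {n : ℕ} (z : EuclideanSpace ℝ (Fin (n + 1))) {L : ℝ} (hL : 0 < L) :
    ∫ x in Metric.ball (0 : EuclideanSpace ℝ (Fin (n + 1))) (L / 2),
        Real.cos (2 * Real.pi * inner ℝ z x) =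
      Real.pi ^ (((n + 1 : ℕ) : ℝ) / 2) / (2 ^ (n + 1) *
        Real.Gamma (((n + 1 : ℕ) : ℝ) / 2 + 1)) * besselProfile (n + 1) L ‖z‖ := by
  have hG : 0 < Real.Gamma (((n + 1 : ℕ) : ℝ) / 2 + 1) := Real.Gamma_pos_of_pos (by positivity)
  by_cases hz : z = 0
  · subst hz
    simp only [inner_zero_left, mul_zero, Real.cos_zero, besselProfile, norm_zero, if_true]
    rw [setIntegral_const, measureReal_def, EuclideanSpace.volume_ball, ← ENNReal.ofReal_pow
      (by positivity), ← ENNReal.ofReal_mul (by positivity), Fintype.card_fin,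
      ENNReal.toReal_ofReal (by positivity), Real.sqrt_eq_rpow, ← Real.rpow_natCast (_ ^ _),
      ← Real.rpow_mul Real.pi_pos.le]
    rw [show (1 / 2 : ℝ) * ((n + 1 : ℕ) : ℝ) = ((n + 1 : ℕ) : ℝ) / 2 by ring, smul_eq_mul, mul_one,
      div_pow]
    field_simp
  · have hr : 0 < ‖z‖ := norm_pos_iff.2 hz
    rw [setIntegral_ball_cos_eq_tsum z (by positivity), besselProfile, if_neg hr.ne', besselJ]
    simp only [← tsum_mul_left]
    rw [← tsum_div_const, ← tsum_mul_left]
    refine tsum_congr fun m => ?_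
    have hGm : 0 < Real.Gamma (m + ((n : ℝ) + 1) / 2 + 1) := Real.Gamma_pos_of_pos (by positivity)
    push_cast at hG ⊢
    set ν : ℝ := ((n : ℝ) + 1) / 2 with hν
    set r := ‖z‖
    have hpr : 0 < Real.pi * r := by positivity
    rw [show L * Real.pi * r / 2 = (L / 2) * (Real.pi * r) by ring,
      Real.rpow_add (by positivity), show 2 * (m : ℝ) = ((2 * m : ℕ) : ℝ) by push_cast; ring,
      Real.rpow_natCast, Real.mul_rpow (by positivity) hpr.le, Real.div_rpow hL.le zero_le_two,
      mul_pow, pow_add]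
    -- Since `ν` is half the dimension, the volume factor supplies two powers `L ^ ν`: the prefactor
    -- of the profile and the one inside the Bessel series.
    have hL2 : (L / 2) ^ (n + 1) = L ^ ν * L ^ ν / 2 ^ (n + 1) := by
      rw [← Real.rpow_add hL, div_pow, hν, add_halves]
      norm_cast
    rw [hL2]
    have h2 : (0 : ℝ) < 2 ^ ν := by positivity
    have h3 : 0 < (Real.pi * r) ^ ν := by positivity
    field_simp
    rw [← mul_pow, ← mul_pow]
    congr 1
    ring

/-! ### First and second moments of integrals against a random measure. -/

section RandomMeasure

variable {X Ω : Type*} [MeasurableSpace X] [MeasurableSpace Ω] {P : Measure Ω}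
  {N : Ω → Measure X}

/-- The hypothesis says that the averaged measure `P.bind N` is `ν`. -/
theorem lintegral_lintegral_of_intensity (hN : Measurable N) {ν : Measure X}
    (h : ∀ A, MeasurableSet A → ∫⁻ ω, N ω A ∂P = ν A) {g : X → ENNReal} (hg : Measurable g) :
    ∫⁻ ω, ∫⁻ x, g x ∂N ω ∂P = ∫⁻ x, g x ∂ν := by
  have hb : P.bind N = ν := by
    ext A hA
    rw [Measure.bind_apply hA hN.aemeasurable, h A hA]
  rw [← hb, Measure.lintegral_bind hN.aemeasurable hg.aemeasurable]

/-- Campbell's formula for products of linear statistics. -/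
theorem lintegral_lintegral_mul_lintegral (hN : Measurable N) {m : Measure (X × X)}
    (h : ∀ A B, MeasurableSet A → MeasurableSet B → ∫⁻ ω, N ω A * N ω B ∂P = m (A ×ˢ B))
    {g k : X → ENNReal} (hg : Measurable g) (hk : Measurable k) :
    ∫⁻ ω, (∫⁻ x, g x ∂N ω) * (∫⁻ x, k x ∂N ω) ∂P = ∫⁻ p, g p.1 * k p.2 ∂m := by
  have hmeas : ∀ {u : X → ENNReal}, Measurable u → Measurable fun ω => ∫⁻ x, u x ∂N ω :=
    fun hu => (Measure.measurable_lintegral hu).comp hN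
  have hcoe : ∀ {A : Set X}, MeasurableSet A → Measurable fun ω => N ω A :=
    fun hA => (Measure.measurable_coe hA).comp hN
  have hfst : ∀ {u : X → ENNReal}, Measurable u → Measurable fun p : X × X => u p.1 :=
    fun hu => hu.comp measurable_fst
  have hsnd : ∀ {u : X → ENNReal}, Measurable u → Measurable fun p : X × X => u p.2 :=
    fun hu => hu.comp measurable_snd
  -- The second moment is only known on rectangles. Passing from indicators to functions in one
  -- variable at a time keeps within them, and needs no finiteness of `m`.
  have step : ∀ {A : Set X}, MeasurableSet A → ∀ {k : X → ENNReal}, Measurable k →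
      ∫⁻ ω, N ω A * (∫⁻ x, k x ∂N ω) ∂P = ∫⁻ p, A.indicator 1 p.1 * k p.2 ∂m := by
    intro A hA k hk
    have hNA := hcoe hA
    have hIA : Measurable fun p : X × X => A.indicator (1 : X → ENNReal) p.1 :=
      (measurable_one.indicator hA).comp measurable_fst
    refine Measurable.ennreal_induction (motive := fun k => ∫⁻ ω, N ω A * (∫⁻ x, k x ∂N ω) ∂P =
      ∫⁻ p, A.indicator 1 p.1 * k p.2 ∂m) ?_ ?_ ?_ hk
    · intro c B hB
      simp only [lintegral_indicator_const hB]
      calc _ = ∫⁻ ω, c * (N ω A * N ω B) ∂P := by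
            refine lintegral_congr fun ω => ?_; ring
        _ = c * m (A ×ˢ B) := by
            rw [lintegral_const_mul _ (hNA.fun_mul (hcoe hB)), h A B hA hB]
        _ = ∫⁻ p, (A ×ˢ B).indicator (fun _ => c) p ∂m := by
            rw [lintegral_indicator_const (hA.prod hB)]
        _ = _ := by
            refine lintegral_congr fun p => ?_
            by_cases h1 : p.1 ∈ A <;> by_cases h2 : p.2 ∈ B <;>
              simp [Set.mem_prod, h1, h2]
    · intro u v _ hu hv ihu ihv
      simp only [Pi.add_apply, lintegral_add_left hu, mul_add]
      rw [lintegral_add_left (hNA.fun_mul (hmeas hu)), ihu, ihv,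
        lintegral_add_left (hIA.fun_mul (hsnd hu))]
    · intro u hu hmono ih
      simp only [lintegral_iSup hu hmono, ENNReal.mul_iSup]
      rw [lintegral_iSup (fun n => hNA.fun_mul (hmeas (hu n))) fun i j hij ω =>
          mul_le_mul_right (lintegral_mono (hmono hij)) _,
        lintegral_iSup (fun n => hIA.fun_mul (hsnd (hu n))) fun i j hij p =>
          mul_le_mul_right (hmono hij p.2) _]
      simp only [ih]
  refine Measurable.ennreal_induction (motive := fun g => ∫⁻ ω, (∫⁻ x, g x ∂N ω) *
    (∫⁻ x, k x ∂N ω) ∂P = ∫⁻ p, g p.1 * k p.2 ∂m) ?_ ?_ ?_ hg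
  · intro c A hA
    have hIA : Measurable fun p : X × X => A.indicator (1 : X → ENNReal) p.1 :=
      (measurable_one.indicator hA).comp measurable_fst
    simp only [lintegral_indicator_const hA, mul_assoc]
    rw [lintegral_const_mul _ ((hcoe hA).fun_mul (hmeas hk)), step hA hk,
      ← lintegral_const_mul _ (hIA.fun_mul (hsnd hk))]
    refine lintegral_congr fun p => ?_
    by_cases h1 : p.1 ∈ A <;> simp [h1]
  · intro u v _ hu hv ihu ihv
    simp only [Pi.add_apply, lintegral_add_left hu, add_mul]
    rw [lintegral_add_left ((hmeas hu).fun_mul (hmeas hk)), ihu, ihv,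
      lintegral_add_left ((hfst hu).fun_mul (hsnd hk))]
  · intro u hu hmono ih
    simp only [lintegral_iSup hu hmono, ENNReal.iSup_mul]
    rw [lintegral_iSup (fun n => (hmeas (hu n)).fun_mul (hmeas hk)) fun i j hij ω =>
        mul_le_mul_left (lintegral_mono (hmono hij)) _,
      lintegral_iSup (fun n => (hfst (hu n)).fun_mul (hsnd hk))
        fun i j hij p => mul_le_mul_left (hmono hij p.1) _]
    simp only [ih]

/-- The positive and negative parts of the real and the imaginary part of `z`. -/
def quarterPart (i : Fin 4) (z : ℂ) : ℝ := ![max z.re 0, max (-z.re) 0, max z.im 0, max (-z.im) 0] i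

/-- The coefficients in `z = re⁺ - re⁻ + i (im⁺ - im⁻)`. -/
def quarterCoeff (i : Fin 4) : ℂ := ![1, -1, Complex.I, -Complex.I] i

theorem quarterPart_nonneg (i : Fin 4) (z : ℂ) : 0 ≤ quarterPart i z := by
  fin_cases i <;> simp [quarterPart]

theorem quarterPart_le (i : Fin 4) (z : ℂ) : quarterPart i z ≤ ‖z‖ := by
  have h1 := abs_le.1 (Complex.abs_re_le_norm z)
  have h2 := abs_le.1 (Complex.abs_im_le_norm z)
  have h3 := norm_nonneg z
  fin_cases i <;> simp [quarterPart] <;> linarith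

theorem measurable_quarterPart (i : Fin 4) : Measurable (quarterPart i) := by
  fin_cases i <;>
    first
    | exact Complex.measurable_re.max measurable_const
    | exact Complex.measurable_re.neg.max measurable_const
    | exact Complex.measurable_im.max measurable_const
    | exact Complex.measurable_im.neg.max measurable_const

/-- Reduces complex statistics to nonnegative ones, for which the moment formulas hold without
integrability assumptions. -/
theorem sum_quarterCoeff_mul_quarterPart (z : ℂ) :
    ∑ i, quarterCoeff i * (quarterPart i z : ℂ) = z := by
  have h : ∀ a : ℝ, max a 0 + -max (-a) 0 = a := fun a => by
    rcases le_total a 0 with ha | ha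
    · rw [max_eq_right ha, max_eq_left (by linarith)]; ring
    · rw [max_eq_left ha, max_eq_right (by linarith)]; ring
  simp only [Fin.sum_univ_four, quarterCoeff, quarterPart]
  apply Complex.ext
  · simpa [-max_zero_sub_max_neg_zero_eq_self] using h z.re
  · simpa [-max_zero_sub_max_neg_zero_eq_self] using h z.im

theorem integrable_of_lintegral_ofReal {Y : Type*} [MeasurableSpace Y] {μ : Measure Y} {u : Y → ℝ}
    (hu : Measurable u) (h0 : ∀ y, 0 ≤ u y) (hfin : ∫⁻ y, ENNReal.ofReal (u y) ∂μ ≠ ⊤) :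
    Integrable u μ :=
  ⟨hu.aestronglyMeasurable,
    (hasFiniteIntegral_iff_ofReal (Eventually.of_forall h0)).2 hfin.lt_top⟩

theorem measurable_integral_quarterPart (hN : Measurable N) {f : X → ℂ} (hf : Measurable f)
    (i : Fin 4) : Measurable fun ω => ∫ x, quarterPart i (f x) ∂N ω := by
  have h : ∀ ω, ∫ x, quarterPart i (f x) ∂N ω =
      (∫⁻ x, ENNReal.ofReal (quarterPart i (f x)) ∂N ω).toReal := fun ω =>
    integral_eq_lintegral_of_nonneg_ae (Eventually.of_forall fun x => quarterPart_nonneg i _)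
      ((measurable_quarterPart i).comp hf).aestronglyMeasurable
  simp only [h]
  exact ((Measure.measurable_lintegral ((measurable_quarterPart i).comp hf).ennreal_ofReal).comp
    hN).ennreal_toReal

theorem integral_eq_sum_quarterPart {f : X → ℂ} (hf : Measurable f) {ν : Measure X}
    (hi : Integrable f ν) :
    ∫ x, f x ∂ν = ∑ i, quarterCoeff i * ((∫ x, quarterPart i (f x) ∂ν : ℝ) : ℂ) := by
  have hint : ∀ i, Integrable (fun x => quarterPart i (f x)) ν := fun i =>
    hi.norm.mono' ((measurable_quarterPart i).comp hf).aestronglyMeasurable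
      (Eventually.of_forall fun x => by
        rw [Real.norm_of_nonneg (quarterPart_nonneg i _)]; exact quarterPart_le i _)
  calc _ = ∫ x, ∑ i, quarterCoeff i * (quarterPart i (f x) : ℂ) ∂ν := by
        simp only [sum_quarterCoeff_mul_quarterPart]
    _ = _ := by
        rw [integral_finsetSum _ fun i _ => (hint i).ofReal.const_mul _]
        simp only [integral_const_mul, integral_complex_ofReal]

/-- Second moments of complex linear statistics of a random measure. -/
theorem memLp_integral_and_integral_mul_conj (hN : Measurable N) {m : Measure (X × X)}
    (h : ∀ A B, MeasurableSet A → MeasurableSet B → ∫⁻ ω, N ω A * N ω B ∂P = m (A ×ˢ B))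
    {f : X → ℂ} (hf : Measurable f) (hint : ∀ᵐ ω ∂P, Integrable f (N ω))
    (hfin : ∫⁻ p, ‖f p.1‖ₑ * ‖f p.2‖ₑ ∂m ≠ ⊤) :
    MemLp (fun ω => ∫ x, f x ∂N ω) 2 P ∧
      ∫ ω, (∫ x, f x ∂N ω) * (starRingEnd ℂ) (∫ x, f x ∂N ω) ∂P =
        ∫ p, f p.1 * (starRingEnd ℂ) (f p.2) ∂m := by
  have hq : ∀ i, Measurable fun x => quarterPart i (f x) := fun i =>
    (measurable_quarterPart i).comp hf
  set T : Fin 4 → Ω → ℝ := fun i ω => ∫ x, quarterPart i (f x) ∂N ω with hT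
  have hTm : ∀ i, Measurable (T i) := measurable_integral_quarterPart hN hf
  have hT0 : ∀ i ω, 0 ≤ T i ω := fun i ω => integral_nonneg fun x => quarterPart_nonneg i _
  have hS : (fun ω => ∫ x, f x ∂N ω) =ᵐ[P] fun ω => ∑ i, quarterCoeff i * (T i ω : ℂ) := by
    filter_upwards [hint] with ω hω using integral_eq_sum_quarterPart hf hω
  -- This holds only almost surely: where `f` is not integrable, the real integral may be the
  -- default value 0.
  have hTl : ∀ᵐ ω ∂P, ∀ i, ENNReal.ofReal (T i ω) =
      ∫⁻ x, ENNReal.ofReal (quarterPart i (f x)) ∂N ω := by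
    filter_upwards [hint] with ω hω i
    refine ofReal_integral_eq_lintegral_ofReal ?_
      (Eventually.of_forall fun x => quarterPart_nonneg i _)
    exact hω.norm.mono' (hq i).aestronglyMeasurable
      (Eventually.of_forall fun x => by
        rw [Real.norm_of_nonneg (quarterPart_nonneg i _)]; exact quarterPart_le i _)
  have hTT : ∀ i j, ∫⁻ ω, ENNReal.ofReal (T i ω * T j ω) ∂P =
      ∫⁻ p, ENNReal.ofReal (quarterPart i (f p.1) * quarterPart j (f p.2)) ∂m := by
    intro i j
    have h1 := lintegral_lintegral_mul_lintegral hN h (hq i).ennreal_ofReal (hq j).ennreal_ofReal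
    calc _ = _ := by
          refine lintegral_congr_ae ?_
          filter_upwards [hTl] with ω hω
          rw [ENNReal.ofReal_mul (hT0 i ω), hω i, hω j]
      _ = _ := h1
      _ = _ := by
          refine lintegral_congr fun p => ?_
          rw [ENNReal.ofReal_mul (quarterPart_nonneg i _)]
  have hfin' : ∀ i j, ∫⁻ p, ENNReal.ofReal (quarterPart i (f p.1) * quarterPart j (f p.2)) ∂m
      ≠ ⊤ := by
    intro i j
    refine ne_top_of_le_ne_top hfin (lintegral_mono fun p => ?_)
    rw [ENNReal.ofReal_mul (quarterPart_nonneg i _), ← ofReal_norm, ← ofReal_norm]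
    gcongr <;> exact quarterPart_le _ _
  have hTTm : ∀ i j, Measurable fun ω => T i ω * T j ω := fun i j => (hTm i).mul (hTm j)
  have hqqm : ∀ i j, Measurable fun p : X × X => quarterPart i (f p.1) * quarterPart j (f p.2) :=
    fun i j => ((hq i).comp measurable_fst).mul ((hq j).comp measurable_snd)
  have hTTi : ∀ i j, Integrable (fun ω => T i ω * T j ω) P := fun i j =>
    integrable_of_lintegral_ofReal (hTTm i j) (fun ω => mul_nonneg (hT0 i ω) (hT0 j ω))
      (by rw [hTT]; exact hfin' i j)
  have hqqi : ∀ i j, Integrable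
      (fun p : X × X => quarterPart i (f p.1) * quarterPart j (f p.2)) m := fun i j =>
    integrable_of_lintegral_ofReal (hqqm i j)
      (fun p => mul_nonneg (quarterPart_nonneg i _) (quarterPart_nonneg j _)) (hfin' i j)
  have hTTe : ∀ i j, ∫ ω, T i ω * T j ω ∂P =
      ∫ p, quarterPart i (f p.1) * quarterPart j (f p.2) ∂m := by
    intro i j
    rw [integral_eq_lintegral_of_nonneg_ae
        (Eventually.of_forall fun ω => mul_nonneg (hT0 i ω) (hT0 j ω))
        (hTTm i j).aestronglyMeasurable, hTT,
      integral_eq_lintegral_of_nonneg_ae (Eventually.of_forall fun p =>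
        mul_nonneg (quarterPart_nonneg i _) (quarterPart_nonneg j _))
        (hqqm i j).aestronglyMeasurable]
  constructor
  · refine MemLp.ae_eq hS.symm (memLp_finsetSum _ fun i _ => MemLp.const_mul ?_ _)
    refine MemLp.ofReal ((memLp_two_iff_integrable_sq (hTm i).aestronglyMeasurable).2 ?_)
    simpa only [sq] using hTTi i i
  · have hexp : ∀ (a b : Fin 4 → ℝ), (∑ i, quarterCoeff i * (a i : ℂ)) *
        (starRingEnd ℂ) (∑ j, quarterCoeff j * (b j : ℂ)) =
        ∑ i, ∑ j, (quarterCoeff i * (starRingEnd ℂ) (quarterCoeff j)) * ((a i * b j : ℝ) : ℂ) := by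
      intro a b
      rw [map_sum, Finset.sum_mul_sum]
      refine Finset.sum_congr rfl fun i _ => Finset.sum_congr rfl fun j _ => ?_
      rw [map_mul, Complex.conj_ofReal]
      push_cast; ring
    calc _ = ∫ ω, ∑ i, ∑ j, (quarterCoeff i * (starRingEnd ℂ) (quarterCoeff j)) *
          ((T i ω * T j ω : ℝ) : ℂ) ∂P := by
          refine integral_congr_ae ?_
          filter_upwards [hS] with ω hω
          rw [hω, hexp]
      _ = ∑ i, ∑ j, (quarterCoeff i * (starRingEnd ℂ) (quarterCoeff j)) *
          ((∫ ω, T i ω * T j ω ∂P : ℝ) : ℂ) := by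
          rw [integral_finsetSum _ fun i _ => integrable_finsetSum _ fun j _ =>
            (hTTi i j).ofReal.const_mul _]
          refine Finset.sum_congr rfl fun i _ => ?_
          rw [integral_finsetSum _ fun j _ => (hTTi i j).ofReal.const_mul _]
          simp only [integral_const_mul, integral_complex_ofReal]
      _ = ∫ p, ∑ i, ∑ j, (quarterCoeff i * (starRingEnd ℂ) (quarterCoeff j)) *
          ((quarterPart i (f p.1) * quarterPart j (f p.2) : ℝ) : ℂ) ∂m := by
          rw [integral_finsetSum _ fun i _ => integrable_finsetSum _ fun j _ =>
            (hqqi i j).ofReal.const_mul _]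
          refine Finset.sum_congr rfl fun i _ => ?_
          rw [integral_finsetSum _ fun j _ => (hqqi i j).ofReal.const_mul _]
          simp only [integral_const_mul, integral_complex_ofReal, hTTe]
      _ = _ := by
          refine integral_congr_ae (Eventually.of_forall fun p => ?_)
          simp only
          rw [← hexp, sum_quarterCoeff_mul_quarterPart, sum_quarterCoeff_mul_quarterPart]

end RandomMeasure

section RandomMeasure

variable {X Ω : Type*} [MeasurableSpace X] [MeasurableSpace Ω] {P : Measure Ω}
  {N : Ω → Measure X}

theorem ae_integrable_of_intensity (hN : Measurable N) {ν : Measure X}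
    (h : ∀ A, MeasurableSet A → ∫⁻ ω, N ω A ∂P = ν A) {f : X → ℂ} (hf : Measurable f)
    (hi : Integrable f ν) : ∀ᵐ ω ∂P, Integrable f (N ω) := by
  have h1 := lintegral_lintegral_of_intensity hN h hf.enorm
  have h2 : ∫⁻ ω, ∫⁻ x, ‖f x‖ₑ ∂N ω ∂P ≠ ⊤ := h1 ▸ hi.2.ne
  have h3 := ae_lt_top ((Measure.measurable_lintegral hf.enorm).comp hN) h2
  filter_upwards [h3] with ω hω using ⟨hf.aestronglyMeasurable, hω⟩

theorem integral_integral_of_intensity (hN : Measurable N) {ν : Measure X}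
    (h : ∀ A, MeasurableSet A → ∫⁻ ω, N ω A ∂P = ν A) {f : X → ℂ} (hf : Measurable f)
    (hi : Integrable f ν) : ∫ ω, ∫ x, f x ∂N ω ∂P = ∫ x, f x ∂ν := by
  have hae := ae_integrable_of_intensity hN h hf hi
  have hq : ∀ i, Measurable fun x => quarterPart i (f x) := fun i =>
    (measurable_quarterPart i).comp hf
  have hle : ∀ i x, ‖quarterPart i (f x)‖ ≤ ‖f x‖ := fun i x => by
    rw [Real.norm_of_nonneg (quarterPart_nonneg i _)]; exact quarterPart_le i _
  have hTm := measurable_integral_quarterPart hN hf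
  have hT0 : ∀ i ω, 0 ≤ ∫ x, quarterPart i (f x) ∂N ω := fun i ω =>
    integral_nonneg fun x => quarterPart_nonneg i _
  have hTl : ∀ i, ∫⁻ ω, ENNReal.ofReal (∫ x, quarterPart i (f x) ∂N ω) ∂P =
      ∫⁻ x, ENNReal.ofReal (quarterPart i (f x)) ∂ν := by
    intro i
    rw [← lintegral_lintegral_of_intensity hN h (hq i).ennreal_ofReal]
    refine lintegral_congr_ae ?_
    filter_upwards [hae] with ω hω
    exact ofReal_integral_eq_lintegral_ofReal (hω.norm.mono' (hq i).aestronglyMeasurable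
      (Eventually.of_forall (hle i))) (Eventually.of_forall fun x => quarterPart_nonneg i _)
  have hTi : ∀ i, Integrable (fun ω => ∫ x, quarterPart i (f x) ∂N ω) P := by
    intro i
    refine integrable_of_lintegral_ofReal (hTm i) (hT0 i) ?_
    rw [hTl]
    refine ne_top_of_le_ne_top hi.2.ne (lintegral_mono fun x => ?_)
    rw [← ofReal_norm]
    exact ENNReal.ofReal_le_ofReal (quarterPart_le i _)
  have hTe : ∀ i, ∫ ω, ∫ x, quarterPart i (f x) ∂N ω ∂P = ∫ x, quarterPart i (f x) ∂ν := by
    intro i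
    rw [integral_eq_lintegral_of_nonneg_ae (Eventually.of_forall (hT0 i))
      (hTm i).aestronglyMeasurable, hTl,
      integral_eq_lintegral_of_nonneg_ae (Eventually.of_forall fun x => quarterPart_nonneg i _)
      (hq i).aestronglyMeasurable]
  calc _ = ∫ ω, ∑ i, quarterCoeff i * ((∫ x, quarterPart i (f x) ∂N ω : ℝ) : ℂ) ∂P := by
        refine integral_congr_ae ?_
        filter_upwards [hae] with ω hω using integral_eq_sum_quarterPart hf hω
    _ = ∑ i, quarterCoeff i * ((∫ x, quarterPart i (f x) ∂ν : ℝ) : ℂ) := by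
        rw [integral_finsetSum _ fun i _ => (hTi i).ofReal.const_mul _]
        simp only [integral_const_mul, integral_complex_ofReal, hTe]
    _ = _ := (integral_eq_sum_quarterPart hf hi).symm

end RandomMeasure

/-! ### Variance from the second moment measure. -/

section SecondMoment

variable {X Ω : Type*} [MeasurableSpace X] [MeasurableSpace Ω] {P : Measure Ω}
  {K : X → X → ℝ} {μ : Measure X} [SigmaFinite μ] {κ : ℝ}

/-- The second moment measure of a determinantal process with kernel `K`, `K(x, x) = κ`. -/
noncomputable def secondMomentMeasure {X : Type*} [MeasurableSpace X] (K : X → X → ℝ)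
    (μ : Measure X) (κ : ℝ) : Measure (X × X) :=
  ENNReal.ofReal κ • μ.map (fun x => (x, x)) +
    (μ.prod μ).withDensity fun p => ENNReal.ofReal (κ ^ 2 - K p.1 p.2 ^ 2)

theorem complexVariance_eq [IsProbabilityMeasure P] {Z : Ω → ℂ} (hZ : MemLp Z 2 P) :
    (complexVariance P Z : ℂ) = ∫ ω, Z ω * (starRingEnd ℂ) (Z ω) ∂P -
      (∫ ω, Z ω ∂P) * (starRingEnd ℂ) (∫ ω, Z ω ∂P) := by
  set c := ∫ ω, Z ω ∂P with hc
  have hZ1 : Integrable Z P := hZ.integrable one_le_two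
  have hZc : Integrable (fun ω => (starRingEnd ℂ) (Z ω)) P :=
    (Complex.conjLIE.toContinuousLinearEquiv.integrable_comp_iff).2 hZ1
  have hZZ : Integrable (fun ω => Z ω * (starRingEnd ℂ) (Z ω)) P := by
    have := hZ.integrable_norm_pow two_ne_zero
    refine this.ofReal.congr (Eventually.of_forall fun ω => ?_)
    simp [Complex.mul_conj, Complex.normSq_eq_norm_sq]
  rw [complexVariance, ← integral_complex_ofReal]
  have : ∀ ω, ((‖Z ω - c‖ ^ 2 : ℝ) : ℂ) = Z ω * (starRingEnd ℂ) (Z ω) -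
      (starRingEnd ℂ) c * Z ω - c * (starRingEnd ℂ) (Z ω) + c * (starRingEnd ℂ) c := by
    intro ω
    rw [← Complex.normSq_eq_norm_sq, ← Complex.mul_conj, map_sub]; ring
  simp only [← hc, this]
  have h1 : Integrable (fun ω => Z ω * (starRingEnd ℂ) (Z ω) - (starRingEnd ℂ) c * Z ω) P :=
    hZZ.sub (hZ1.const_mul _)
  have h2 : Integrable (fun ω => Z ω * (starRingEnd ℂ) (Z ω) - (starRingEnd ℂ) c * Z ω -
      c * (starRingEnd ℂ) (Z ω)) P := h1.sub (hZc.const_mul _)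
  rw [integral_add h2 (integrable_const _), integral_sub h1 (hZc.const_mul _),
    integral_sub hZZ (hZ1.const_mul _), integral_const_mul, integral_const_mul, integral_conj,
    ← hc, integral_const, probReal_univ, one_smul]
  ring

/-- The diagonal part is controlled by the L² norm; the off-diagonal part has density at most `κ ^
2` and is controlled by the L¹ norm. -/
theorem lintegral_enorm_mul_secondMomentMeasure_ne_top
    (hK : Measurable fun p : X × X => K p.1 p.2) {f : X → ℂ} (hf : Measurable f)
    (h1 : Integrable f μ) (h2 : MemLp f 2 μ) :
    ∫⁻ p, ‖f p.1‖ₑ * ‖f p.2‖ₑ ∂secondMomentMeasure K μ κ ≠ ⊤ := by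
  have hρ : Measurable fun p : X × X => ENNReal.ofReal (κ ^ 2 - K p.1 p.2 ^ 2) :=
    (measurable_const.sub (hK.pow_const 2)).ennreal_ofReal
  have hm : Measurable fun p : X × X => ‖f p.1‖ₑ * ‖f p.2‖ₑ :=
    (hf.comp measurable_fst).enorm.mul (hf.comp measurable_snd).enorm
  rw [secondMomentMeasure, lintegral_add_measure, lintegral_smul_measure,
    lintegral_map hm (measurable_id'.prodMk measurable_id'),
    lintegral_withDensity_eq_lintegral_mul _ hρ hm]
  refine ENNReal.add_ne_top.2 ⟨ENNReal.mul_ne_top ENNReal.ofReal_ne_top ?_, ?_⟩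
  · have := h2.eLpNorm_ne_top
    rw [eLpNorm_eq_lintegral_rpow_enorm_toReal two_ne_zero ENNReal.ofNat_ne_top] at this
    intro h
    simp only [← sq] at h
    simp [h] at this
  · refine ne_top_of_le_ne_top (b := ENNReal.ofReal (κ ^ 2) * ((∫⁻ x, ‖f x‖ₑ ∂μ) * ∫⁻ x, ‖f x‖ₑ ∂μ))
      (ENNReal.mul_ne_top ENNReal.ofReal_ne_top (ENNReal.mul_ne_top h1.2.ne h1.2.ne)) ?_
    rw [← lintegral_prod_mul hf.enorm.aemeasurable hf.enorm.aemeasurable,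
      ← lintegral_const_mul _ hm]
    refine lintegral_mono fun p => ?_
    simp only [Pi.mul_apply]
    gcongr
    nlinarith [sq_nonneg (K p.1 p.2)]

theorem integral_secondMomentMeasure (hκ : 0 ≤ κ) (hbound : ∀ x y, |K x y| ≤ κ)
    (hK : Measurable fun p : X × X => K p.1 p.2) {f : X → ℂ} (hf : Measurable f)
    (h1 : Integrable f μ) (h2 : MemLp f 2 μ) :
    ∫ p, f p.1 * (starRingEnd ℂ) (f p.2) ∂secondMomentMeasure K μ κ =
      κ * ∫ x, f x * (starRingEnd ℂ) (f x) ∂μ +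
      ((κ * ∫ x, f x ∂μ) * (starRingEnd ℂ) (κ * ∫ x, f x ∂μ) -
        ∫ p, (K p.1 p.2 ^ 2 : ℝ) * (f p.1 * (starRingEnd ℂ) (f p.2)) ∂μ.prod μ) := by
  have hρ : Measurable fun p : X × X => ENNReal.ofReal (κ ^ 2 - K p.1 p.2 ^ 2) :=
    (measurable_const.sub (hK.pow_const 2)).ennreal_ofReal
  have hfc : Measurable fun x => (starRingEnd ℂ) (f x) := Complex.continuous_conj.measurable.comp hf
  have hm : Measurable fun p : X × X => f p.1 * (starRingEnd ℂ) (f p.2) :=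
    (hf.comp measurable_fst).mul (hfc.comp measurable_snd)
  have hint : Integrable (fun p : X × X => f p.1 * (starRingEnd ℂ) (f p.2))
      (secondMomentMeasure K μ κ) := by
    refine ⟨hm.aestronglyMeasurable, ?_⟩
    have := lintegral_enorm_mul_secondMomentMeasure_ne_top (κ := κ) hK hf h1 h2
    refine lt_of_le_of_lt (le_of_eq (lintegral_congr fun p => ?_)) this.lt_top
    rw [enorm_mul]; congr 1
    exact RCLike.enorm_conj _
  rw [secondMomentMeasure, integrable_add_measure] at hint
  have hpp : Integrable (fun p : X × X => f p.1 * (starRingEnd ℂ) (f p.2)) (μ.prod μ) :=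
    h1.mul_prod ((Complex.conjLIE.toContinuousLinearEquiv.integrable_comp_iff).2 h1)
  have hKsq : ∀ p : X × X, K p.1 p.2 ^ 2 ≤ κ ^ 2 := fun p =>
    sq_le_sq' (neg_le_of_abs_le (hbound _ _)) (le_of_abs_le (hbound _ _))
  have hKpp : Integrable (fun p : X × X => ((K p.1 p.2 ^ 2 : ℝ) : ℂ) *
      (f p.1 * (starRingEnd ℂ) (f p.2))) (μ.prod μ) := by
    refine hpp.bdd_mul (c := κ ^ 2) (hK.pow_const 2).complex_ofReal.aestronglyMeasurable
      (Eventually.of_forall fun p => ?_)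
    rw [Complex.norm_real, Real.norm_of_nonneg (sq_nonneg _)]
    exact hKsq p
  rw [secondMomentMeasure, integral_add_measure hint.1 hint.2, integral_smul_measure,
    integral_map (measurable_id'.prodMk measurable_id').aemeasurable hm.aestronglyMeasurable,
    ENNReal.toReal_ofReal hκ, Complex.real_smul,
    integral_withDensity_eq_integral_toReal_smul hρ (Eventually.of_forall fun _ =>
      ENNReal.ofReal_lt_top)]
  congr 1
  -- The bound `|K| ≤ κ` makes the density nonnegative, so `ENNReal.ofReal` truncates nothing.
  have : ∀ p : X × X, (ENNReal.ofReal (κ ^ 2 - K p.1 p.2 ^ 2)).toReal •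
      (f p.1 * (starRingEnd ℂ) (f p.2)) = (κ ^ 2 : ℂ) * (f p.1 * (starRingEnd ℂ) (f p.2)) -
      ((K p.1 p.2 ^ 2 : ℝ) : ℂ) * (f p.1 * (starRingEnd ℂ) (f p.2)) := by
    intro p
    rw [ENNReal.toReal_ofReal (sub_nonneg.2 (hKsq p)), Complex.real_smul]
    push_cast; ring
  simp only [this]
  rw [integral_sub (hpp.const_mul _) hKpp, integral_const_mul,
    integral_prod_mul (fun x => f x) (fun x => (starRingEnd ℂ) (f x)), integral_conj, map_mul,
    Complex.conj_ofReal]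
  ring

end SecondMoment

/-! ### Determinantal processes as random counting measures. -/

theorem encard_distinctTuples_one {X : Type*} (S A : Set X) :
    (distinctTuples S 1 {x | x 0 ∈ A}).encard = (S ∩ A).encard := by
  have : S ∩ A = (fun x : Fin 1 → X => x 0) '' distinctTuples S 1 {x | x 0 ∈ A} := by
    ext y
    constructor
    · rintro ⟨h1, h2⟩
      exact ⟨fun _ => y, ⟨fun i j _ => Subsingleton.elim i j, fun _ => h1, h2⟩, rfl⟩
    · rintro ⟨x, ⟨-, h1, h2⟩, rfl⟩
      exact ⟨h1 0, h2⟩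
  rw [this, Set.InjOn.encard_image]
  intro x _ y _ hxy
  ext i
  rw [Subsingleton.elim i 0]
  exact hxy

/-- The joint intensities only see pairs of distinct points, so the pairs counted by the product are
split according to whether their two points coincide. -/
theorem encard_mul_encard_eq {X : Type*} (S A B : Set X) :
    (S ∩ A).encard * (S ∩ B).encard =
      (S ∩ (A ∩ B)).encard + (distinctTuples S 2 {x | x 0 ∈ A ∧ x 1 ∈ B}).encard := by
  have h : (S ∩ A) ×ˢ (S ∩ B) = ((fun y : X => (y, y)) '' (S ∩ (A ∩ B))) ∪
      ((fun x : Fin 2 → X => (x 0, x 1)) '' distinctTuples S 2 {x | x 0 ∈ A ∧ x 1 ∈ B}) := by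
    ext ⟨a, b⟩
    constructor
    · rintro ⟨⟨h1, h2⟩, h3, h4⟩
      simp only at h1 h2 h3 h4
      by_cases hab : a = b
      · subst hab
        exact Or.inl ⟨a, ⟨h1, h2, h4⟩, rfl⟩
      · refine Or.inr ⟨![a, b], ⟨?_, ?_, h2, h4⟩, rfl⟩
        · intro i j hij
          fin_cases i <;> fin_cases j <;> simp_all [eq_comm]
        · intro i
          fin_cases i <;> simpa
    · rintro (⟨y, ⟨h1, h2, h3⟩, h4⟩ | ⟨x, ⟨-, h1, h2, h3⟩, h4⟩)
      · obtain ⟨rfl, rfl⟩ := Prod.mk.inj h4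
        exact ⟨⟨h1, h2⟩, h1, h3⟩
      · obtain ⟨rfl, rfl⟩ := Prod.mk.inj h4
        exact ⟨⟨h1 0, h2⟩, h1 1, h3⟩
  rw [← Set.encard_prod, h, Set.encard_union_eq, Set.InjOn.encard_image, Set.InjOn.encard_image]
  · intro x _ y _ hxy
    obtain ⟨h0, h1⟩ := Prod.mk.inj hxy
    ext i
    fin_cases i
    · exact h0
    · exact h1
  · intro x _ y _ hxy
    exact (Prod.mk.inj hxy).1
  · rw [Set.disjoint_left]
    rintro _ ⟨y, -, rfl⟩ ⟨x, ⟨hx, -⟩, hxy⟩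
    obtain ⟨h0, h1⟩ := Prod.mk.inj hxy
    exact zero_ne_one (hx (h0.trans h1.symm))

section Determinantal

variable {X Ω : Type*} [MetricSpace X] [MeasurableSpace X] [MeasurableSpace Ω]
  {P : Measure Ω} {Ξ : Ω → Set X}

/-- The counting measure of the points of `Ξ ω`. -/
noncomputable def pointMeasure (Ξ : Ω → Set X) (ω : Ω) : Measure X := Measure.count.restrict (Ξ ω)

/-- Balls of integer radius exhaust the space and each contains finitely many points. Countability
makes `Ξ ω` measurable and turns integrals against `pointMeasure` into sums. -/
theorem IsSimplePointProcess.countable (h : IsSimplePointProcess Ξ) (ω : Ω) :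
    (Ξ ω).Countable := by
  rcases isEmpty_or_nonempty X with hX | ⟨⟨x₀⟩⟩
  · exact Set.to_countable _
  · have : Ξ ω = ⋃ n : ℕ, Ξ ω ∩ Metric.ball x₀ n := by
      rw [← Set.inter_iUnion, Metric.iUnion_ball_nat, Set.inter_univ]
    rw [this]
    exact Set.countable_iUnion fun n => (h.finite_inter ω _ Metric.isBounded_ball).countable

variable [BorelSpace X]

theorem IsSimplePointProcess.pointMeasure_apply (h : IsSimplePointProcess Ξ) (ω : Ω) {A : Set X}
    (hA : MeasurableSet A) : pointMeasure Ξ ω A = ((Ξ ω ∩ A).encard : ENNReal) := by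
  rw [pointMeasure, Measure.restrict_apply hA, Set.inter_comm,
    Measure.count_apply ((h.countable ω).measurableSet.inter hA)]

theorem IsSimplePointProcess.measurable_pointMeasure (h : IsSimplePointProcess Ξ) :
    Measurable (pointMeasure Ξ) := by
  refine Measure.measurable_of_measurable_coe _ fun A hA => ?_
  simp only [h.pointMeasure_apply _ hA]
  exact (Measurable.of_discrete (f := ENat.toENNReal)).comp (h.measurable_count A hA)

variable {K : X → X → ℝ} {μ : Measure X} {κ : ℝ}

theorem IsDeterminantal.lintegral_pointMeasure (h : IsDeterminantal P Ξ K μ)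
    (hdiag : ∀ x, K x x = κ) {A : Set X} (hA : MeasurableSet A) :
    ∫⁻ ω, pointMeasure Ξ ω A ∂P = (ENNReal.ofReal κ • μ) A := by
  have hA' : MeasurableSet {x : Fin 1 → X | x 0 ∈ A} := measurable_pi_apply 0 hA
  simp only [(IsDeterminantal.isSimplePointProcess h).pointMeasure_apply _ hA]
  have h1 := h.jointIntensity 1 _ hA'
  simp only [encard_distinctTuples_one, Matrix.det_fin_one, Matrix.of_apply, hdiag] at h1
  rw [h1, setLIntegral_const, Measure.smul_apply, smul_eq_mul]
  congr 1
  exact (measurePreserving_funUnique μ (Fin 1)).measure_preimage hA.nullMeasurableSet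

/-- Coincident pairs give the first intensity of `A ∩ B`, carried by the diagonal; distinct pairs
have the 2 × 2 determinant `κ ^ 2 - K ^ 2` as density. -/
theorem IsDeterminantal.lintegral_pointMeasure_mul (h : IsDeterminantal P Ξ K μ)
    [SigmaFinite μ] (hdiag : ∀ x, K x x = κ) (hsymm : ∀ x y, K x y = K y x)
    (hK : Measurable fun p : X × X => K p.1 p.2) {A B : Set X} (hA : MeasurableSet A)
    (hB : MeasurableSet B) :
    ∫⁻ ω, pointMeasure Ξ ω A * pointMeasure Ξ ω B ∂P = secondMomentMeasure K μ κ (A ×ˢ B) := by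
  have hAB : MeasurableSet {x : Fin 2 → X | x 0 ∈ A ∧ x 1 ∈ B} :=
    Measurable.prodMk (f := fun x : Fin 2 → X => x 0) (g := fun x => x 1)
      (measurable_pi_apply 0) (measurable_pi_apply 1) (hA.prod hB)
  have hρ : Measurable fun p : X × X => ENNReal.ofReal (κ ^ 2 - K p.1 p.2 ^ 2) :=
    (measurable_const.sub (hK.pow_const 2)).ennreal_ofReal
  have h0 := IsDeterminantal.isSimplePointProcess h
  have h1 : ∀ ω, pointMeasure Ξ ω A * pointMeasure Ξ ω B = pointMeasure Ξ ω (A ∩ B) +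
      ((distinctTuples (Ξ ω) 2 {x | x 0 ∈ A ∧ x 1 ∈ B}).encard : ENNReal) := by
    intro ω
    rw [h0.pointMeasure_apply ω hA, h0.pointMeasure_apply ω hB,
      h0.pointMeasure_apply ω (hA.inter hB), ← ENat.toENNReal_mul, encard_mul_encard_eq,
      ENat.toENNReal_add]
  simp only [h1]
  have hm : Measurable fun ω => pointMeasure Ξ ω (A ∩ B) :=
    (Measure.measurable_coe (hA.inter hB)).comp h0.measurable_pointMeasure
  rw [lintegral_add_left hm,
    h.lintegral_pointMeasure hdiag (hA.inter hB), h.jointIntensity 2 _ hAB, secondMomentMeasure,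
    Measure.add_apply, Measure.smul_apply, Measure.smul_apply,
    Measure.map_apply (measurable_id'.prodMk measurable_id') (hA.prod hB),
    withDensity_apply _ (hA.prod hB)]
  congr 1
  have hmp := measurePreserving_piFinTwo (fun _ : Fin 2 => μ)
  rw [← hmp.setLIntegral_comp_preimage (hA.prod hB) hρ]
  refine lintegral_congr fun x => ?_
  simp only [Matrix.det_fin_two, Matrix.of_apply, hdiag, hsymm (x 1) (x 0),
    MeasurableEquiv.piFinTwo_apply]
  ring_nf

theorem IsSimplePointProcess.linearStatistic_eq_integral (h : IsSimplePointProcess Ξ) {f : X → ℂ}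
    {ω : Ω} (hf : Integrable f (pointMeasure Ξ ω)) :
    (Summable fun x : Ξ ω => f x) ∧ linearStatistic Ξ f ω = ∫ x, f x ∂pointMeasure Ξ ω := by
  constructor
  · have h1 : ∫⁻ x in Ξ ω, ‖f x‖ₑ ∂Measure.count < ⊤ := hf.2
    rw [lintegral_countable _ (h.countable ω)] at h1
    simp only [Measure.count_singleton, mul_one] at h1
    refine Summable.of_norm ?_
    simpa only [coe_nnnorm] using
      NNReal.summable_coe.2 (ENNReal.tsum_coe_ne_top_iff_summable.1 h1.ne)
  · rw [pointMeasure, setIntegral_countable f (h.countable ω) hf]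
    simp [linearStatistic, Measure.real]

/-- Variance of the linear statistics of a determinantal process with bounded constant-diagonal
symmetric kernel. -/
theorem IsDeterminantal.summable_and_memLp_and_complexVariance [SigmaFinite μ]
    [IsProbabilityMeasure P] (h : IsDeterminantal P Ξ K μ) (hκ : 0 ≤ κ) (hdiag : ∀ x, K x x = κ)
    (hsymm : ∀ x y, K x y = K y x) (hbound : ∀ x y, |K x y| ≤ κ)
    (hK : Measurable fun p : X × X => K p.1 p.2) {f : X → ℂ}
    (h1 : Integrable f μ) (h2 : MemLp f 2 μ) :
    (∀ᵐ ω ∂P, Summable fun x : Ξ ω => f x) ∧ MemLp (linearStatistic Ξ f) 2 P ∧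
      (complexVariance P (linearStatistic Ξ f) : ℂ) =
        κ * ∫ x, f x * (starRingEnd ℂ) (f x) ∂μ -
          ∫ p, (K p.1 p.2 ^ 2 : ℝ) * (f p.1 * (starRingEnd ℂ) (f p.2)) ∂μ.prod μ := by
  have h0 := IsDeterminantal.isSimplePointProcess h
  have hN := h0.measurable_pointMeasure
  have hint1 : ∀ A, MeasurableSet A → ∫⁻ ω, pointMeasure Ξ ω A ∂P = (ENNReal.ofReal κ • μ) A :=
    fun A hA => h.lintegral_pointMeasure hdiag hA
  obtain ⟨g, hg, hfg⟩ := h1.aestronglyMeasurable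
  have hgm : Measurable g := hg.measurable
  have hg1 : Integrable g μ := h1.congr hfg
  have hg2 : MemLp g 2 μ := h2.ae_eq hfg
  have hg1' : Integrable g (ENNReal.ofReal κ • μ) := hg1.smul_measure ENNReal.ofReal_ne_top
  have hgN := ae_integrable_of_intensity hN hint1 hgm hg1'
  -- A `μ`-null set contains 0 points on average, hence almost surely none; so changing `f` on such
  -- a set does not affect the statistic.
  have hfgN : ∀ᵐ ω ∂P, f =ᵐ[pointMeasure Ξ ω] g := by
    obtain ⟨s, hs, hsm, hs0⟩ := exists_measurable_superset_of_null hfg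
    have h3 : ∫⁻ ω, pointMeasure Ξ ω s ∂P = 0 := by
      rw [hint1 s hsm, Measure.smul_apply, hs0, smul_zero]
    have h4 : Measurable fun ω => pointMeasure Ξ ω s := (Measure.measurable_coe hsm).comp hN
    rw [lintegral_eq_zero_iff h4] at h3
    filter_upwards [h3] with ω hω using measure_mono_null hs hω
  have hfN : ∀ᵐ ω ∂P, Integrable f (pointMeasure Ξ ω) := by
    filter_upwards [hgN, hfgN] with ω h3 h4 using h3.congr h4.symm
  have heq : linearStatistic Ξ f =ᵐ[P] fun ω => ∫ x, g x ∂pointMeasure Ξ ω := by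
    filter_upwards [hfN, hfgN] with ω h3 h4
    rw [(h0.linearStatistic_eq_integral h3).2, integral_congr_ae h4]
  obtain ⟨h5, h6⟩ := memLp_integral_and_integral_mul_conj hN
    (fun A B hA hB => h.lintegral_pointMeasure_mul hdiag hsymm hK hA hB) hgm hgN
    (lintegral_enorm_mul_secondMomentMeasure_ne_top hK hgm hg1 hg2)
  have h7 := integral_integral_of_intensity hN hint1 hgm hg1'
  rw [integral_smul_measure, ENNReal.toReal_ofReal hκ, Complex.real_smul] at h7
  refine ⟨?_, h5.ae_eq heq.symm, ?_⟩
  · filter_upwards [hfN] with ω hω using (h0.linearStatistic_eq_integral hω).1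
  · have h8 : complexVariance P (linearStatistic Ξ f) =
        complexVariance P (fun ω => ∫ x, g x ∂pointMeasure Ξ ω) := by
      rw [complexVariance, complexVariance, integral_congr_ae heq]
      refine integral_congr_ae ?_
      filter_upwards [heq] with ω hω
      rw [hω]
    rw [h8, complexVariance_eq h5, h6, h7, integral_secondMomentMeasure hκ hbound hK hgm hg1 hg2]
    have h9 : ∫ x, f x * (starRingEnd ℂ) (f x) ∂μ = ∫ x, g x * (starRingEnd ℂ) (g x) ∂μ := by
      refine integral_congr_ae ?_
      filter_upwards [hfg] with x hx
      rw [hx]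
    have h10 : ∫ p, (K p.1 p.2 ^ 2 : ℝ) * (f p.1 * (starRingEnd ℂ) (f p.2)) ∂μ.prod μ =
        ∫ p, (K p.1 p.2 ^ 2 : ℝ) * (g p.1 * (starRingEnd ℂ) (g p.2)) ∂μ.prod μ := by
      refine integral_congr_ae ?_
      filter_upwards [Measure.quasiMeasurePreserving_fst.ae hfg,
        Measure.quasiMeasurePreserving_snd.ae hfg] with p hp1 hp2
      rw [hp1, hp2]
    rw [h9, h10]
    ring

end Determinantal

/-! ### The variance on the Fourier side. -/

section Fourier

open FourierTransform

variable {V : Type*} [NormedAddCommGroup V] [InnerProductSpace ℝ V] [FiniteDimensional ℝ V]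
  [MeasurableSpace V] [BorelSpace V]

theorem continuous_fourier_of_integrable {f : V → ℂ} (hf : Integrable f) : Continuous (𝓕 f) :=
  VectorFourier.fourierIntegral_continuous Real.continuous_fourierChar
    (by exact continuous_inner) hf

theorem norm_fourier_le_integral_norm (f : V → ℂ) (w : V) : ‖𝓕 f w‖ ≤ ∫ v, ‖f v‖ :=
  VectorFourier.norm_fourierIntegral_le_integral_norm _ _ _ _ _

/-- The Fourier transform on `L²` agrees with the Fourier integral on `L¹ ∩ L²`. -/
theorem fourier_toLp_ae_eq {f : V → ℂ} (h1 : Integrable f) (h2 : MemLp f 2) :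
    (𝓕 (h2.toLp f) : Lp ℂ 2 (volume : Measure V)) =ᵐ[volume] 𝓕 f := by
  refine ae_eq_of_integral_contDiff_smul_eq ?_
    (continuous_fourier_of_integrable h1).locallyIntegrable ?_
  · exact (Lp.memLp _).locallyIntegrable one_le_two
  -- A smooth compactly supported test function is a Schwartz function. Against it the L² transform
  -- acts as the distributional one, and Fubini moves the Fourier integral from the test function to
  -- `f`.
  · intro g hg hgc
    have hg₁ : HasCompactSupport (Complex.ofRealCLM ∘ g) := hgc.comp_left rfl
    have hg₂ : ContDiff ℝ (⊤ : ℕ∞) (Complex.ofRealCLM ∘ g) := by fun_prop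
    set φ := hg₁.toSchwartzMap hg₂ with hφ
    have hφg : ∀ x, φ x = (g x : ℂ) := fun x => rfl
    have e1 := congrArg (fun T => T φ) (Lp.fourier_toTemperedDistribution_eq (h2.toLp f))
    simp only [TemperedDistribution.fourier_apply, Lp.toTemperedDistribution_apply] at e1
    have e2 : ∫ x, (𝓕 φ) x • (h2.toLp f) x = ∫ x, (𝓕 φ) x • f x := by
      refine integral_congr_ae ?_
      filter_upwards [h2.coeFn_toLp] with x hx
      rw [hx]
    have e3 : ∫ x, (𝓕 φ) x • f x = ∫ x, φ x • 𝓕 f x := by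
      simpa [SchwartzMap.fourier_coe] using!
        (VectorFourier.integral_fourierIntegral_smul_eq_flip (L := innerₗ V)
          Real.continuous_fourierChar continuous_inner φ.integrable h1)
    simp only [← Complex.coe_smul, ← hφg]
    rw [← e1, e2, e3]

theorem lintegral_enorm_fourier_sq {f : V → ℂ} (h1 : Integrable f) (h2 : MemLp f 2) :
    ∫⁻ w, ‖𝓕 f w‖ₑ ^ 2 = ∫⁻ v, ‖f v‖ₑ ^ 2 := by
  have h := congrArg ENNReal.ofReal (Lp.norm_fourier_eq (h2.toLp f))
  rw [Lp.norm_def, Lp.norm_def, ENNReal.ofReal_toReal (Lp.eLpNorm_ne_top _),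
    ENNReal.ofReal_toReal (Lp.eLpNorm_ne_top _), eLpNorm_congr_ae (fourier_toLp_ae_eq h1 h2),
    eLpNorm_congr_ae h2.coeFn_toLp,
    eLpNorm_eq_lintegral_rpow_enorm_toReal two_ne_zero ENNReal.ofNat_ne_top,
    eLpNorm_eq_lintegral_rpow_enorm_toReal two_ne_zero ENNReal.ofNat_ne_top] at h
  exact ENNReal.rpow_left_injective (x := 1 / 2) (by norm_num) (by simpa using h)

/-- The Fourier transform of the indicator of the ball of radius `R`. -/
noncomputable def ballKernel (R : ℝ) (z : V) : ℝ :=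
  ∫ x in Metric.ball (0 : V) R, Real.cos (2 * Real.pi * inner ℝ z x)

theorem setIntegral_ball_neg (R : ℝ) (g : V → ℂ) :
    ∫ x in Metric.ball (0 : V) R, g (-x) = ∫ x in Metric.ball (0 : V) R, g x := by
  have h := (Measure.measurePreserving_neg (volume : Measure V)).setIntegral_preimage_emb
    (MeasurableEquiv.neg V).measurableEmbedding g (Metric.ball 0 R)
  rw [← h]
  congr 2
  ext x
  simp

/-- The ball is symmetric under `x ↦ -x`, so the sine part integrates to zero. -/
theorem ofReal_ballKernel (R : ℝ) (z : V) :
    (ballKernel R z : ℂ) = ∫ x in Metric.ball (0 : V) R,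
      Complex.exp ((-2 * Real.pi * inner ℝ z x : ℝ) * Complex.I) := by
  have hint : ∀ s : ℝ, IntegrableOn
      (fun x : V => Complex.exp ((s * Real.pi * inner ℝ z x : ℝ) * Complex.I))
      (Metric.ball (0 : V) R) := fun s =>
    ((Continuous.continuousOn (by fun_prop)).integrableOn_compact
      (isCompact_closedBall (0 : V) R)).mono_set Metric.ball_subset_closedBall
  have h1 := setIntegral_ball_neg R
    fun x : V => Complex.exp ((-2 * Real.pi * inner ℝ z x : ℝ) * Complex.I)
  rw [ballKernel, ← integral_complex_ofReal]
  have h2 : ∀ x : V, ((Real.cos (2 * Real.pi * inner ℝ z x) : ℝ) : ℂ) =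
      (1 / 2 : ℂ) * (Complex.exp ((2 * Real.pi * inner ℝ z x : ℝ) * Complex.I) +
        Complex.exp ((-2 * Real.pi * inner ℝ z x : ℝ) * Complex.I)) := by
    intro x
    rw [Complex.ofReal_cos, Complex.cos]
    rw [show -2 * Real.pi * inner ℝ z x = -(2 * Real.pi * inner ℝ z x) by ring, Complex.ofReal_neg]
    ring
  simp only [h2]
  rw [integral_const_mul, integral_add (hint 2) (hint (-2)), ← h1]
  simp only [inner_neg_right, neg_mul, mul_neg, neg_neg]
  ring

/-- The kernel is written as an integral twice, with one variable reflected; the square then depends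
on the pair only through its difference. -/
theorem ofReal_ballKernel_sq (R : ℝ) (z : V) :
    ((ballKernel R z ^ 2 : ℝ) : ℂ) = ∫ p : V × V,
      Complex.exp ((-2 * Real.pi * inner ℝ z (p.1 - p.2) : ℝ) * Complex.I)
      ∂((volume.restrict (Metric.ball (0 : V) R)).prod
        (volume.restrict (Metric.ball (0 : V) R))) := by
  have h := integral_prod_mul (μ := volume.restrict (Metric.ball (0 : V) R))
    (ν := volume.restrict (Metric.ball (0 : V) R))
    (fun x : V => Complex.exp ((-2 * Real.pi * inner ℝ z x : ℝ) * Complex.I))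
    (fun x : V => Complex.exp ((-2 * Real.pi * inner ℝ z (-x) : ℝ) * Complex.I))
  rw [setIntegral_ball_neg R
    fun x : V => Complex.exp ((-2 * Real.pi * inner ℝ z x : ℝ) * Complex.I),
    ← ofReal_ballKernel] at h
  rw [sq, Complex.ofReal_mul, ← h]
  refine integral_congr_ae (Eventually.of_forall fun p => ?_)
  simp only
  rw [← Complex.exp_add]
  congr 1
  rw [inner_neg_right, inner_sub_right]
  push_cast
  ring

/-- After Fubini the inner integral over `q` factors as 𝓕 f(w) times its conjugate, at w = p.1 -
p.2. The exchange is legitimate because the exponentials have modulus 1, the balls have finite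
volume and `f` is integrable. -/
theorem integral_ballKernel_sq_mul {f : V → ℂ} (hf : Integrable f) (R : ℝ) :
    ∫ q : V × V, (ballKernel R (q.1 - q.2) ^ 2 : ℝ) * (f q.1 * (starRingEnd ℂ) (f q.2))
      ∂(volume.prod volume) =
    ((∫ p : V × V, ‖𝓕 f (p.1 - p.2)‖ ^ 2
      ∂((volume.restrict (Metric.ball (0 : V) R)).prod
        (volume.restrict (Metric.ball (0 : V) R))) : ℝ) : ℂ) := by
  set ν := volume.restrict (Metric.ball (0 : V) R) with hν
  have : IsFiniteMeasure ν := ⟨by simpa [hν] using measure_ball_lt_top⟩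
  let e : V → V → ℂ := fun x w => Complex.exp ((-2 * Real.pi * inner ℝ x w : ℝ) * Complex.I)
  have hec : Continuous fun p : V × V => e p.1 p.2 := by fun_prop
  have he1 : ∀ x w, ‖e x w‖ = 1 := fun x w => Complex.norm_exp_ofReal_mul_I _
  have hfc : Integrable (fun x => (starRingEnd ℂ) (f x)) :=
    (Complex.conjLIE.toContinuousLinearEquiv.integrable_comp_iff).2 hf
  have heF : ∀ w, ∫ x, e x w * f x = 𝓕 f w := fun w => by
    rw [Real.fourier_eq']; rfl
  calc _ = ∫ q : V × V, ∫ p : V × V, e (q.1 - q.2) (p.1 - p.2) *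
        (f q.1 * (starRingEnd ℂ) (f q.2)) ∂(ν.prod ν) ∂(volume.prod volume) := by
        refine integral_congr_ae (Eventually.of_forall fun q => ?_)
        simp only
        rw [ofReal_ballKernel_sq, ← integral_mul_const]
    _ = ∫ p : V × V, ∫ q : V × V, e (q.1 - q.2) (p.1 - p.2) *
        (f q.1 * (starRingEnd ℂ) (f q.2)) ∂(volume.prod volume) ∂(ν.prod ν) := by
        refine integral_integral_swap ?_
        have h1 : Integrable (fun z : (V × V) × V × V => (f z.1.1 * (starRingEnd ℂ) (f z.1.2)) *
            (1 : ℂ)) ((volume.prod volume).prod (ν.prod ν)) :=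
          (hf.mul_prod hfc).mul_prod (integrable_const 1)
        simp only [mul_one] at h1
        refine h1.bdd_mul (c := 1) (f := fun z : (V × V) × V × V =>
          e (z.1.1 - z.1.2) (z.2.1 - z.2.2)) ?_ (Eventually.of_forall fun z => (he1 _ _).le)
        exact Continuous.aestronglyMeasurable (by fun_prop)
    _ = ∫ p : V × V, ((‖𝓕 f (p.1 - p.2)‖ ^ 2 : ℝ) : ℂ) ∂(ν.prod ν) := by
        refine integral_congr_ae (Eventually.of_forall fun p => ?_)
        simp only
        set w := p.1 - p.2
        rw [← Complex.normSq_eq_norm_sq, ← Complex.mul_conj, ← heF, ← integral_conj,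
          ← integral_prod_mul]
        refine integral_congr_ae (Eventually.of_forall fun q => ?_)
        simp only [map_mul]
        have : e (q.1 - q.2) w = e q.1 w * (starRingEnd ℂ) (e q.2 w) := by
          simp only [e]
          rw [← Complex.exp_conj, ← Complex.exp_add]
          congr 1
          simp only [inner_sub_left, map_mul, Complex.conj_ofReal, Complex.conj_I]
          push_cast
          ring
        rw [this]
        ring
    _ = _ := integral_complex_ofReal

theorem measurable_volume_ball_diff_ball (R : ℝ) :
    Measurable fun w : V => volume (Metric.ball (0 : V) R \ Metric.ball w R) := by
  have hs : MeasurableSet {p : V × V | p.2 ∈ Metric.ball (0 : V) R ∧ R ≤ dist p.2 p.1} := by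
    rw [Set.ofPred_and]
    exact (measurable_snd measurableSet_ball).inter (measurableSet_le (by fun_prop) (by fun_prop))
  convert measurable_measure_prodMk_left (ν := (volume : Measure V)) hs using 3 with w
  ext x
  simp

/-- Fourier representation of the variance of a linear statistic. -/
theorem ballKernel_variance_eq {f : V → ℂ} (h1 : Integrable f) (h2 : MemLp f 2) (R : ℝ) :
    (volume.real (Metric.ball (0 : V) R) : ℂ) * (∫ x, f x * (starRingEnd ℂ) (f x)) -
      ∫ q : V × V, (ballKernel R (q.1 - q.2) ^ 2 : ℝ) * (f q.1 * (starRingEnd ℂ) (f q.2))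
        ∂(volume.prod volume) =
    ((∫ w, ‖𝓕 f w‖ ^ 2 * volume.real (Metric.ball (0 : V) R \ Metric.ball w R) : ℝ) : ℂ) := by
  set B := Metric.ball (0 : V) R with hB
  set ν := volume.restrict B with hν
  have hBfin : volume B ≠ ⊤ := measure_ball_lt_top.ne
  have : IsFiniteMeasure ν := ⟨by simpa [hν] using hBfin.lt_top⟩
  have hcont := continuous_fourier_of_integrable h1
  have hFint : Integrable fun w => ‖𝓕 f w‖ ^ 2 := by
    have : MemLp (𝓕 f) 2 := (Lp.memLp _).ae_eq (fourier_toLp_ae_eq h1 h2)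
    exact this.integrable_norm_pow two_ne_zero
  have hplanch : ∫ x, f x * (starRingEnd ℂ) (f x) = ((∫ w, ‖𝓕 f w‖ ^ 2 : ℝ) : ℂ) := by
    have e1 : ∫ x, ‖f x‖ ^ 2 = ∫ w, ‖𝓕 f w‖ ^ 2 := by
      rw [integral_eq_lintegral_of_nonneg_ae (Eventually.of_forall fun x => sq_nonneg _)
        (h1.aestronglyMeasurable.norm.pow 2),
        integral_eq_lintegral_of_nonneg_ae (Eventually.of_forall fun x => sq_nonneg _)
        hFint.aestronglyMeasurable]
      congr 1
      simpa only [ENNReal.ofReal_pow (norm_nonneg _), ofReal_norm] using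
        (lintegral_enorm_fourier_sq h1 h2).symm
    rw [← e1, ← integral_complex_ofReal]
    refine integral_congr_ae (Eventually.of_forall fun x => ?_)
    simp only
    rw [Complex.mul_conj, Complex.normSq_eq_norm_sq]
  rw [integral_ballKernel_sq_mul h1, hplanch, ← Complex.ofReal_mul, ← Complex.ofReal_sub]
  congr 1
  have hmeasB : MeasurableSet B := measurableSet_ball
  -- Pairs of points of the ball are grouped by their difference `w`; those with a given `w` have
  -- their first point in the ball and in its translate by `w`.
  have hdouble : ∫ p : V × V, ‖𝓕 f (p.1 - p.2)‖ ^ 2 ∂(ν.prod ν) =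
      ∫ w, ‖𝓕 f w‖ ^ 2 * volume.real (B ∩ Metric.ball w R) := by
    have hbd : ∀ w, ‖‖𝓕 f w‖ ^ 2‖ ≤ (∫ v, ‖f v‖) ^ 2 := fun w => by
      rw [Real.norm_of_nonneg (sq_nonneg _)]
      exact pow_le_pow_left₀ (norm_nonneg _) (norm_fourier_le_integral_norm f w) 2
    have hi : Integrable (fun p : V × V => ‖𝓕 f (p.1 - p.2)‖ ^ 2) (ν.prod ν) :=
      Integrable.of_bound (Continuous.aestronglyMeasurable (by fun_prop)) _
        (Eventually.of_forall fun p => hbd _)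
    have hmem : ∀ x w : V, x - w ∈ B ↔ x ∈ Metric.ball w R := fun x w => by
      rw [hB, mem_ball_zero_iff, Metric.mem_ball, dist_eq_norm]
    rw [integral_prod _ hi]
    calc _ = ∫ x, ∫ w, ‖𝓕 f w‖ ^ 2 * B.indicator (fun _ => (1 : ℝ)) (x - w) ∂volume ∂ν := by
          refine integral_congr_ae (Eventually.of_forall fun x => ?_)
          simp only
          rw [hν, ← integral_indicator hmeasB, ← integral_sub_left_eq_self _ volume x]
          refine integral_congr_ae (Eventually.of_forall fun w => ?_)
          by_cases hw : x - w ∈ B <;> simp [hw]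
      _ = ∫ w, ∫ x, ‖𝓕 f w‖ ^ 2 * B.indicator (fun _ => (1 : ℝ)) (x - w) ∂ν := by
          refine integral_integral_swap ?_
          have h3 : Integrable (fun z : V × V => (1 : ℝ) * ‖𝓕 f z.2‖ ^ 2) (ν.prod volume) :=
            (integrable_const (1 : ℝ)).mul_prod hFint
          simp only [one_mul] at h3
          refine h3.mul_bdd (c := 1) (g := fun z : V × V =>
            B.indicator (fun _ => (1 : ℝ)) (z.1 - z.2)) ?_ (Eventually.of_forall fun z => ?_)
          · exact ((measurable_const.indicator hmeasB).comp
              (measurable_fst.sub measurable_snd)).aestronglyMeasurable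
          · by_cases hz : z.1 - z.2 ∈ B <;> simp [hz]
      _ = _ := by
          refine integral_congr_ae (Eventually.of_forall fun w => ?_)
          simp only
          rw [integral_const_mul]
          congr 1
          have : (fun x => B.indicator (fun _ => (1 : ℝ)) (x - w)) =
              (Metric.ball w R).indicator fun _ => 1 := by
            ext x
            by_cases hx : x - w ∈ B
            · rw [Set.indicator_of_mem hx, Set.indicator_of_mem ((hmem x w).1 hx)]
            · rw [Set.indicator_of_notMem hx,
                Set.indicator_of_notMem fun h => hx ((hmem x w).2 h)]
          rw [this, integral_indicator_const _ measurableSet_ball, smul_eq_mul, mul_one,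
            measureReal_def, hν, Measure.restrict_apply measurableSet_ball, Set.inter_comm,
            measureReal_def]
  have hsplit : ∀ w, volume.real (B \ Metric.ball w R) =
      volume.real B - volume.real (B ∩ Metric.ball w R) := fun w => by
    rw [eq_sub_iff_add_eq, add_comm, measureReal_inter_add_sdiff measurableSet_ball hBfin]
  have hmi : Integrable fun w => ‖𝓕 f w‖ ^ 2 * volume.real (B ∩ Metric.ball w R) := by
    refine hFint.mul_bdd (c := volume.real B) ?_ (Eventually.of_forall fun w => ?_)
    · have h4 : (fun w => volume.real (B ∩ Metric.ball w R)) =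
          fun w => volume.real B - volume.real (B \ Metric.ball w R) :=
        funext fun w => by rw [hsplit]; ring
      rw [h4]
      exact (measurable_const.sub
        (measurable_volume_ball_diff_ball R).ennreal_toReal).aestronglyMeasurable
    · rw [Real.norm_of_nonneg measureReal_nonneg]
      exact measureReal_mono Set.inter_subset_left hBfin
  rw [hdouble, mul_comm, ← integral_mul_const, ← integral_sub (hFint.mul_const _) hmi]
  refine integral_congr_ae (Eventually.of_forall fun w => ?_)
  simp only [hsplit]
  ring

end Fourier

/-! ### Extension by density from L¹ ∩ L² to L². -/

section LTwo

variable {Y : Type*} [MeasurableSpace Y] {μ : Measure Y}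

theorem eLpNorm_two_sq_eq_lintegral (f : Y → ℂ) :
    eLpNorm f 2 μ ^ 2 = ∫⁻ y, ‖f y‖ₑ ^ 2 ∂μ := by
  have h := eLpNorm_nnreal_pow_eq_lintegral (f := f) (μ := μ) (p := 2) two_ne_zero
  simpa using h

theorem tendsto_lintegral_sq_of_eLpNorm_sub {g : ℕ → Y → ℂ} {f : Y → ℂ}
    (hg : ∀ n, MemLp (g n) 2 μ) (hf : MemLp f 2 μ)
    (h : Tendsto (fun n => eLpNorm (g n - f) 2 μ) atTop (𝓝 0)) :
    Tendsto (fun n => ∫⁻ y, ‖g n y‖ₑ ^ 2 ∂μ) atTop (𝓝 (∫⁻ y, ‖f y‖ₑ ^ 2 ∂μ)) := by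
  have h1 := ((Lp.tendsto_Lp_iff_tendsto_eLpNorm'' g hg f hf).2 h).norm
  simp only [Lp.norm_toLp] at h1
  rw [ENNReal.tendsto_toReal_iff (fun n => (hg n).eLpNorm_ne_top) hf.eLpNorm_ne_top] at h1
  simp only [← eLpNorm_two_sq_eq_lintegral]
  exact (ENNReal.continuous_pow 2).tendsto _ |>.comp h1

end LTwo

section Fourier

open FourierTransform

variable {V : Type*} [NormedAddCommGroup V] [InnerProductSpace ℝ V] [FiniteDimensional ℝ V]
  [MeasurableSpace V] [BorelSpace V]

theorem exists_tendsto_eLpNorm_sub {f : V → ℂ} (hf : MemLp f 2) :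
    ∃ g : ℕ → V → ℂ, (∀ n, Integrable (g n)) ∧ (∀ n, MemLp (g n) 2) ∧
      Tendsto (fun n => eLpNorm (g n - f) 2 volume) atTop (𝓝 0) := by
  have h : ∀ n : ℕ, ∃ g : V → ℂ, HasCompactSupport g ∧
      eLpNorm (f - g) 2 volume ≤ ((n : ENNReal) + 1)⁻¹ ∧ Continuous g ∧ MemLp g 2 volume := fun n =>
    hf.exists_hasCompactSupport_eLpNorm_sub_le ENNReal.ofNat_ne_top
      (ENNReal.inv_ne_zero.2 (by simp))
  choose g hgc hgn hg hg2 using h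
  refine ⟨g, fun n => (hg n).integrable_of_hasCompactSupport (hgc n), hg2, ?_⟩
  refine tendsto_of_tendsto_of_tendsto_of_le_of_le tendsto_const_nhds
    (h := fun n : ℕ => ((n : ENNReal) + 1)⁻¹) ?_ (fun n => bot_le) fun n => ?_
  · have := (tendsto_add_atTop_iff_nat 1).2 ENNReal.tendsto_inv_nat_nhds_zero
    simpa using this
  · simp only
    rw [eLpNorm_sub_comm]
    exact hgn n

/-- Weighted `L²` norms of the Fourier transform depend continuously on the function. -/
theorem tendsto_lintegral_weight_mul_fourier {g : ℕ → V → ℂ} {f : V → ℂ} (hg : ∀ n, MemLp (g n) 2)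
    (hf : MemLp f 2) (h : Tendsto (fun n => eLpNorm (g n - f) 2 volume) atTop (𝓝 0))
    {W : V → ENNReal} (hW : Measurable W) {C : ENNReal} (hC : C ≠ ⊤) (hWC : ∀ w, W w ≤ C) :
    Tendsto (fun n => ∫⁻ w, W w * ‖(𝓕 ((hg n).toLp (g n)) : Lp ℂ 2 (volume : Measure V)) w‖ₑ ^ 2)
      atTop (𝓝 (∫⁻ w, W w * ‖(𝓕 (hf.toLp f) : Lp ℂ 2 (volume : Measure V)) w‖ₑ ^ 2)) := by
  have h1 : Tendsto (fun n => (𝓕 ((hg n).toLp (g n)) : Lp ℂ 2 (volume : Measure V))) atTop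
      (𝓝 (𝓕 (hf.toLp f))) :=
    ((Lp.fourierTransformₗᵢ V ℂ).continuous.tendsto _).comp
      ((Lp.tendsto_Lp_iff_tendsto_eLpNorm'' g hg f hf).2 h)
  rw [Lp.tendsto_Lp_iff_tendsto_eLpNorm'] at h1
  -- Multiplication by the square root of the weight is bounded on L², so the weighted norm is the
  -- plain norm of a continuous image.
  let m : V → ℂ := fun w => (√(W w).toReal : ℝ)
  have hm : Measurable m := (hW.ennreal_toReal.sqrt).complex_ofReal
  have hm0 : ∀ w, ‖m w‖ = √(W w).toReal := fun w => by
    rw [Complex.norm_real, Real.norm_of_nonneg (Real.sqrt_nonneg _)]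
  have hmC : ∀ w, ‖m w‖ ≤ √C.toReal := fun w => by
    rw [hm0]; exact Real.sqrt_le_sqrt (ENNReal.toReal_mono hC (hWC w))
  have hmW : ∀ w, ‖m w‖ₑ ^ 2 = W w := fun w => by
    rw [← ofReal_norm, hm0, ← ENNReal.ofReal_pow (Real.sqrt_nonneg _),
      Real.sq_sqrt ENNReal.toReal_nonneg, ENNReal.ofReal_toReal]
    exact ne_top_of_le_ne_top hC (hWC w)
  have hmem : ∀ u : Lp ℂ 2 (volume : Measure V), MemLp (fun w => m w * u w) 2 volume := fun u =>
    (Lp.memLp u).of_le_mul (c := √C.toReal)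
      (hm.aestronglyMeasurable.mul (Lp.memLp u).aestronglyMeasurable)
      (Eventually.of_forall fun w => by rw [norm_mul]; gcongr; exact hmC w)
  have key := tendsto_lintegral_sq_of_eLpNorm_sub
    (fun n => hmem (𝓕 ((hg n).toLp (g n)))) (hmem (𝓕 (hf.toLp f))) ?_
  · simpa only [enorm_mul, mul_pow, hmW] using key
  · have h2 := ENNReal.Tendsto.const_mul (a := ENNReal.ofReal √C.toReal) h1
      (Or.inr ENNReal.ofReal_ne_top)
    rw [mul_zero] at h2
    refine tendsto_of_tendsto_of_tendsto_of_le_of_le tendsto_const_nhds h2 (fun n => bot_le)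
      fun n => ?_
    refine eLpNorm_le_mul_eLpNorm_of_ae_le_mul (Eventually.of_forall fun w => ?_) _
    simp only [Pi.sub_apply, ← mul_sub, norm_mul]
    gcongr
    exact hmC w

theorem fourier_translate_sub {f : V → ℂ} (h1 : Integrable f) (z w : V) :
    𝓕 (fun x => f (x + z) - f x) w =
      (Complex.exp ((2 * Real.pi * inner ℝ z w : ℝ) * Complex.I) - 1) * 𝓕 f w := by
  have e1 : 𝓕 (fun x => f (x + z)) w =
      Complex.exp ((2 * Real.pi * inner ℝ z w : ℝ) * Complex.I) * 𝓕 f w := by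
    have := congrFun (VectorFourier.fourierIntegral_comp_add_right Real.fourierChar
      (volume : Measure V) (innerₗ V) f z) w
    simpa [Circle.smul_def, Real.fourierChar_apply] using! this
  have e2 : 𝓕 (fun x => f (x + z) - f x) w = 𝓕 (fun x => f (x + z)) w - 𝓕 f w := by
    simp only [Real.fourier_eq, smul_sub]
    exact integral_sub ((Real.fourierIntegral_convergent_iff w).2 (h1.comp_add_right z))
      ((Real.fourierIntegral_convergent_iff w).2 h1)
  rw [e2, e1]
  ring

theorem enorm_exp_sub_one_sq (x : ℝ) :
    ‖Complex.exp ((x : ℝ) * Complex.I) - 1‖ₑ ^ 2 = ENNReal.ofReal (2 - 2 * Real.cos x) := by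
  rw [← ofReal_norm, ← ENNReal.ofReal_pow (norm_nonneg _), ← Complex.normSq_eq_norm_sq,
    Complex.normSq_apply]
  congr 1
  simp only [Complex.sub_re, Complex.sub_im, Complex.exp_ofReal_mul_I_re,
    Complex.exp_ofReal_mul_I_im, Complex.one_re, Complex.one_im]
  nlinarith [Real.sin_sq_add_cos_sq x]

/-- On L¹ ∩ L² this is Plancherel, the weight being |e^{2πi⟨z,w⟩} - 1|². Both sides are continuous
in L², since the weight is at most 4, so density gives the general case. -/
theorem lintegral_enorm_translate_sub_sq {f : V → ℂ} (hf : MemLp f 2) (z : V) :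
    ∫⁻ x, ‖f (x + z) - f x‖ₑ ^ 2 =
      ∫⁻ w, ENNReal.ofReal (2 - 2 * Real.cos (2 * Real.pi * inner ℝ z w)) *
        ‖(𝓕 (hf.toLp f) : Lp ℂ 2 (volume : Measure V)) w‖ₑ ^ 2 := by
  have hmp : MeasurePreserving (fun x : V => x + z) := measurePreserving_add_right volume z
  have htr : ∀ {u : V → ℂ}, MemLp u 2 → MemLp (fun x => u (x + z)) 2 := fun hu =>
    hu.comp_measurePreserving hmp
  obtain ⟨g, hg1, hg2, hgf⟩ := exists_tendsto_eLpNorm_sub hf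
  have hcos : ∀ x : ℝ, 2 - 2 * Real.cos x ≤ 4 := fun x => by linarith [Real.neg_one_le_cos x]
  have hR := tendsto_lintegral_weight_mul_fourier hg2 hf hgf
    (W := fun w => ENNReal.ofReal (2 - 2 * Real.cos (2 * Real.pi * inner ℝ z w)))
    (by fun_prop) (C := ENNReal.ofReal 4) ENNReal.ofReal_ne_top
    (fun w => ENNReal.ofReal_le_ofReal (hcos _))
  have hL : Tendsto (fun n => ∫⁻ x, ‖g n (x + z) - g n x‖ₑ ^ 2) atTop
      (𝓝 (∫⁻ x, ‖f (x + z) - f x‖ₑ ^ 2)) := by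
    refine tendsto_lintegral_sq_of_eLpNorm_sub (fun n => (htr (hg2 n)).sub (hg2 n))
      ((htr hf).sub hf) ?_
    have h0 : Tendsto (fun n => eLpNorm (g n - f) 2 volume + eLpNorm (g n - f) 2 volume) atTop
        (𝓝 0) := by simpa using hgf.add hgf
    refine tendsto_of_tendsto_of_tendsto_of_le_of_le tendsto_const_nhds h0 (fun n => bot_le)
      fun n => ?_
    have hd : MemLp (g n - f) 2 := (hg2 n).sub hf
    have e1 : eLpNorm (fun x => (g n - f) (x + z)) 2 volume = eLpNorm (g n - f) 2 volume :=
      eLpNorm_comp_measurePreserving hd.aestronglyMeasurable hmp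
    calc _ = eLpNorm ((fun x => (g n - f) (x + z)) - (g n - f)) 2 volume := by
          congr 1; ext x; simp only [Pi.sub_apply]; ring
      _ ≤ _ := eLpNorm_sub_le (htr hd).aestronglyMeasurable hd.aestronglyMeasurable one_le_two
      _ = _ := by rw [e1]
  refine tendsto_nhds_unique hL (hR.congr fun n => ?_)
  have hd1 : Integrable (fun x => g n (x + z) - g n x) :=
    ((hg1 n).comp_add_right z).sub (hg1 n)
  rw [← lintegral_enorm_fourier_sq hd1 ((htr (hg2 n)).sub (hg2 n))]
  refine lintegral_congr_ae ?_
  filter_upwards [fourier_toLp_ae_eq (hg1 n) (hg2 n)] with w hw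
  rw [hw, fourier_translate_sub (hg1 n), enorm_mul, mul_pow, enorm_exp_sub_one_sq]

end Fourier

/-! ### The Gagliardo seminorm as a Fourier multiplier. -/

/-- The substitution t ↦ 1/t turns this into the Gamma integral at 1/2, whose value is √π. -/
theorem lintegral_rpow_mul_exp_neg_div {v : ℝ} (hv : 0 < v) :
    ∫⁻ t in Set.Ioi (0 : ℝ), ENNReal.ofReal (t ^ (-(3 / 2) : ℝ) * Real.exp (-(v / t))) =
      ENNReal.ofReal (√Real.pi * v ^ (-(1 / 2) : ℝ)) := by
  have hpos : 0 < √Real.pi * v ^ (-(1 / 2) : ℝ) := by positivity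
  have h1 := integral_comp_rpow_Ioi (fun y : ℝ => y ^ ((1 / 2 : ℝ) - 1) * Real.exp (-(v * y)))
    (p := -1) (by norm_num)
  rw [Real.integral_rpow_mul_exp_neg_mul_Ioi (by norm_num) hv, Real.Gamma_one_half_eq] at h1
  have h2 : ∫ t in Set.Ioi (0 : ℝ), t ^ (-(3 / 2) : ℝ) * Real.exp (-(v / t)) =
      √Real.pi * v ^ (-(1 / 2) : ℝ) := by
    rw [mul_comm (√Real.pi), Real.rpow_neg hv.le, ← Real.inv_rpow hv.le, ← one_div v, ← h1]
    refine setIntegral_congr_fun measurableSet_Ioi fun t ht => ?_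
    have ht' : (0 : ℝ) < t := ht
    simp only [smul_eq_mul, abs_neg, abs_one, one_mul]
    rw [← Real.rpow_mul ht'.le, ← mul_assoc, ← Real.rpow_add ht', Real.rpow_neg_one]
    norm_num [div_eq_mul_inv]
  have h3 : IntegrableOn (fun t : ℝ => t ^ (-(3 / 2) : ℝ) * Real.exp (-(v / t))) (Set.Ioi 0) := by
    by_contra h
    rw [integral_undef h] at h2
    exact hpos.ne h2
  rw [← ofReal_integral_eq_lintegral_ofReal h3, h2]
  filter_upwards [self_mem_ae_restrict measurableSet_Ioi] with t ht
  have : (0 : ℝ) < t := ht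
  positivity

theorem lintegral_Ioc_rpow_mul_exp_neg_div {a t : ℝ} (ha : 0 ≤ a) (ht : 0 < t) :
    ∫⁻ v in Set.Ioc 0 a, ENNReal.ofReal (t ^ (-(3 / 2) : ℝ) * Real.exp (-(v / t))) =
      ENNReal.ofReal (t ^ (-(1 / 2) : ℝ) * (1 - Real.exp (-(a / t)))) := by
  have hcont : Continuous fun v : ℝ => t ^ (-(3 / 2) : ℝ) * Real.exp (-(v / t)) := by fun_prop
  rw [← ofReal_integral_eq_lintegral_ofReal (hcont.integrableOn_Ioc)
    (Eventually.of_forall fun v => by positivity), ← intervalIntegral.integral_of_le ha,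
    intervalIntegral.integral_eq_sub_of_hasDerivAt
      (f := fun v => -(t ^ (-(1 / 2) : ℝ) * Real.exp (-(v / t)))) _ (hcont.intervalIntegrable _ _)]
  · congr 1
    simp
    ring
  · intro v _
    have h1 : HasDerivAt (fun v : ℝ => -(v / t)) (-(1 / t)) v :=
      ((hasDerivAt_id v).div_const t).neg
    have h2 := (h1.exp.const_mul (t ^ (-(1 / 2) : ℝ))).neg
    convert h2 using 1
    · rfl
    rw [show (-(3 / 2) : ℝ) = -(1 / 2) + -1 by norm_num, Real.rpow_add ht, Real.rpow_neg_one]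
    field_simp

/-- The integrand is itself an integral over 0 < v ≤ a; exchanging leaves √π times the integral of
v^{-1/2}. Applied with `a` a multiple of ‖w‖², this is where the first power ‖w‖ comes from. -/
theorem lintegral_rpow_mul_one_sub_exp {a : ℝ} (ha : 0 ≤ a) :
    ∫⁻ t in Set.Ioi (0 : ℝ), ENNReal.ofReal (t ^ (-(1 / 2) : ℝ) * (1 - Real.exp (-(a / t)))) =
      ENNReal.ofReal (2 * √Real.pi * √a) := by
  calc _ = ∫⁻ t in Set.Ioi (0 : ℝ), ∫⁻ v in Set.Ioc 0 a,
        ENNReal.ofReal (t ^ (-(3 / 2) : ℝ) * Real.exp (-(v / t))) :=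
        setLIntegral_congr_fun measurableSet_Ioi fun t ht =>
          (lintegral_Ioc_rpow_mul_exp_neg_div ha ht).symm
    _ = ∫⁻ v in Set.Ioc 0 a, ∫⁻ t in Set.Ioi (0 : ℝ),
        ENNReal.ofReal (t ^ (-(3 / 2) : ℝ) * Real.exp (-(v / t))) :=
        lintegral_lintegral_swap (Measurable.aemeasurable (by fun_prop))
    _ = ∫⁻ v in Set.Ioc 0 a, ENNReal.ofReal (√Real.pi * v ^ (-(1 / 2) : ℝ)) :=
        setLIntegral_congr_fun measurableSet_Ioc fun v hv => lintegral_rpow_mul_exp_neg_div hv.1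
    _ = _ := by
        have hi : IntegrableOn (fun v : ℝ => √Real.pi * v ^ (-(1 / 2) : ℝ)) (Set.Ioc 0 a) :=
          ((intervalIntegrable_iff_integrableOn_Ioc_of_le ha).1
            (intervalIntegral.intervalIntegrable_rpow' (by norm_num))).const_mul _
        rw [← ofReal_integral_eq_lintegral_ofReal hi, integral_const_mul,
          ← intervalIntegral.integral_of_le ha, integral_rpow (Or.inl (by norm_num))]
        · congr 1
          rw [Real.sqrt_eq_rpow a, show (-(1 / 2) + 1 : ℝ) = 1 / 2 by norm_num,
            Real.zero_rpow (by norm_num)]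
          ring
        · filter_upwards [self_mem_ae_restrict measurableSet_Ioc] with v hv
          have := hv.1
          positivity

section Gaussian

open FourierTransform

variable {V : Type*} [NormedAddCommGroup V] [InnerProductSpace ℝ V] [FiniteDimensional ℝ V]
  [MeasurableSpace V] [BorelSpace V]

theorem integrable_exp_neg_mul_norm_sq {t : ℝ} (ht : 0 < t) :
    Integrable fun z : V => Real.exp (-t * ‖z‖ ^ 2) := by
  have h := GaussianFourier.integral_rexp_neg_mul_sq_norm (V := V) ht
  by_contra hi
  rw [integral_undef hi] at h
  have : 0 < (Real.pi / t) ^ ((Module.finrank ℝ V : ℝ) / 2) := by positivity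
  exact this.ne h

theorem integral_cos_mul_exp_neg_mul_norm_sq {t : ℝ} (ht : 0 < t) (w : V) :
    ∫ z : V, Real.cos (2 * Real.pi * inner ℝ z w) * Real.exp (-t * ‖z‖ ^ 2) =
      (Real.pi / t) ^ ((Module.finrank ℝ V : ℝ) / 2) * Real.exp (-(Real.pi ^ 2 * ‖w‖ ^ 2 / t)) := by
  have h := fourier_gaussian_innerProductSpace (V := V) (b := (t : ℂ)) (by simpa using ht) w
  have h0 : Integrable fun z : V => Complex.exp (-(t : ℂ) * ‖z‖ ^ 2) := by
    refine (integrable_exp_neg_mul_norm_sq (V := V) ht).ofReal.congr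
      (Eventually.of_forall fun z => ?_)
    simp
  have h1 := (Real.fourierIntegral_convergent_iff w).2 h0
  rw [Real.fourier_eq] at h
  have h2 := congrArg Complex.re h
  rw [← Complex.reCLM_apply, ← Complex.reCLM.integral_comp_comm h1] at h2
  calc _ = _ := ?_
    _ = _ := h2
    _ = _ := ?_
  · refine integral_congr_ae (Eventually.of_forall fun z => ?_)
    have e1 : Complex.exp (-(t : ℂ) * ‖z‖ ^ 2) = (Real.exp (-t * ‖z‖ ^ 2) : ℝ) := by simp
    simp only [Complex.reCLM_apply]
    rw [e1, Circle.smul_def, Real.fourierChar_apply, smul_eq_mul, Complex.re_mul_ofReal,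
      Complex.exp_ofReal_mul_I_re, mul_neg, Real.cos_neg]
  · have e2 : (Real.pi / t : ℂ) ^ (Module.finrank ℝ V / 2 : ℂ) *
        Complex.exp (-Real.pi ^ 2 * ‖w‖ ^ 2 / t) =
        (((Real.pi / t) ^ ((Module.finrank ℝ V : ℝ) / 2) *
          Real.exp (-(Real.pi ^ 2 * ‖w‖ ^ 2 / t)) : ℝ) : ℂ) := by
      rw [Complex.ofReal_mul, Complex.ofReal_cpow (by positivity), Complex.ofReal_exp]
      push_cast
      congr 2
      ring
    rw [e2, Complex.ofReal_re]

theorem lintegral_one_sub_cos_mul_exp {t : ℝ} (ht : 0 < t) (w : V) :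
    ∫⁻ z : V, ENNReal.ofReal ((2 - 2 * Real.cos (2 * Real.pi * inner ℝ z w)) *
      Real.exp (-t * ‖z‖ ^ 2)) =
    ENNReal.ofReal (2 * (Real.pi / t) ^ ((Module.finrank ℝ V : ℝ) / 2) *
      (1 - Real.exp (-(Real.pi ^ 2 * ‖w‖ ^ 2 / t)))) := by
  have hg := integrable_exp_neg_mul_norm_sq (V := V) ht
  have hc : Integrable fun z : V =>
      Real.cos (2 * Real.pi * inner ℝ z w) * Real.exp (-t * ‖z‖ ^ 2) :=
    hg.bdd_mul (c := 1) (Continuous.aestronglyMeasurable (by fun_prop))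
      (Eventually.of_forall fun z => Real.abs_cos_le_one _)
  have e : ∀ z : V, (2 - 2 * Real.cos (2 * Real.pi * inner ℝ z w)) * Real.exp (-t * ‖z‖ ^ 2) =
      2 * Real.exp (-t * ‖z‖ ^ 2) -
        2 * (Real.cos (2 * Real.pi * inner ℝ z w) * Real.exp (-t * ‖z‖ ^ 2)) := fun z => by ring
  rw [← ofReal_integral_eq_lintegral_ofReal]
  · simp only [e]
    rw [integral_sub (hg.const_mul 2) (hc.const_mul 2), integral_const_mul, integral_const_mul,
      integral_cos_mul_exp_neg_mul_norm_sq ht, GaussianFourier.integral_rexp_neg_mul_sq_norm ht]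
    congr 1
    ring
  · simp only [e]
    exact (hg.const_mul 2).sub (hc.const_mul 2)
  · refine Eventually.of_forall fun z => mul_nonneg ?_ (Real.exp_pos _).le
    linarith [Real.cos_le_one (2 * Real.pi * inner ℝ z w)]

/-- The symbol of the Gagliardo seminorm of order `1/2`. -/
theorem lintegral_one_sub_cos_div_norm_pow (w : V) :
    ∫⁻ z : V, ENNReal.ofReal ((2 - 2 * Real.cos (2 * Real.pi * inner ℝ z w)) /
      ‖z‖ ^ (Module.finrank ℝ V + 1)) =
    ENNReal.ofReal (4 * Real.pi ^ (((Module.finrank ℝ V : ℝ) + 3) / 2) /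
      Real.Gamma (((Module.finrank ℝ V : ℝ) + 1) / 2) * ‖w‖) := by
  set d := Module.finrank ℝ V with hd
  set s : ℝ := ((d : ℝ) + 1) / 2 with hs
  have hs0 : 0 < s := by positivity
  have hG : 0 < Real.Gamma s := Real.Gamma_pos_of_pos hs0
  have hcos : ∀ z : V, 0 ≤ 2 - 2 * Real.cos (2 * Real.pi * inner ℝ z w) := fun z => by
    linarith [Real.cos_le_one (2 * Real.pi * inner ℝ z w)]
  -- Subordination: ‖z‖^{-2s}, with `2s = d + 1`, is a superposition of Gaussians by the Gamma
  -- integral, and the Fourier transform of each Gaussian is explicit.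
  have hpt : ∀ z : V, ENNReal.ofReal (Real.Gamma s) *
      ENNReal.ofReal ((2 - 2 * Real.cos (2 * Real.pi * inner ℝ z w)) / ‖z‖ ^ (d + 1)) =
      ∫⁻ t in Set.Ioi (0 : ℝ), ENNReal.ofReal (t ^ (s - 1)) *
        ENNReal.ofReal ((2 - 2 * Real.cos (2 * Real.pi * inner ℝ z w)) *
          Real.exp (-t * ‖z‖ ^ 2)) := by
    intro z
    -- At the origin the cosine is 1, so both sides vanish.
    by_cases hz : z = 0
    · subst hz; simp
    have hr : 0 < ‖z‖ := norm_pos_iff.2 hz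
    have h1 := Real.integral_rpow_mul_exp_neg_mul_Ioi hs0 (r := ‖z‖ ^ 2) (by positivity)
    have hpos : 0 < (1 / ‖z‖ ^ 2) ^ s * Real.Gamma s := by positivity
    have h2 : IntegrableOn (fun t : ℝ => t ^ (s - 1) * Real.exp (-(‖z‖ ^ 2 * t))) (Set.Ioi 0) := by
      by_contra h
      rw [integral_undef h] at h1
      exact hpos.ne h1
    have h3 : ∫⁻ t in Set.Ioi (0 : ℝ), ENNReal.ofReal (t ^ (s - 1) * Real.exp (-(‖z‖ ^ 2 * t))) =
        ENNReal.ofReal ((1 / ‖z‖ ^ 2) ^ s * Real.Gamma s) := by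
      rw [← h1, ofReal_integral_eq_lintegral_ofReal h2]
      filter_upwards [self_mem_ae_restrict measurableSet_Ioi] with t ht
      have : (0 : ℝ) < t := ht
      positivity
    have h4 : (1 / ‖z‖ ^ 2) ^ s = 1 / ‖z‖ ^ (d + 1) := by
      rw [← Real.rpow_natCast, ← Real.rpow_natCast, Real.div_rpow zero_le_one (by positivity),
        Real.one_rpow, ← Real.rpow_mul hr.le]
      congr 2
      rw [hs]; push_cast; ring
    calc _ = ENNReal.ofReal (2 - 2 * Real.cos (2 * Real.pi * inner ℝ z w)) *
          ENNReal.ofReal ((1 / ‖z‖ ^ 2) ^ s * Real.Gamma s) := by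
          rw [← ENNReal.ofReal_mul hG.le, ← ENNReal.ofReal_mul (hcos z), h4]
          congr 1
          ring
      _ = _ := by
          rw [← h3, ← lintegral_const_mul' _ _ ENNReal.ofReal_ne_top]
          refine setLIntegral_congr_fun measurableSet_Ioi fun t ht => ?_
          have ht' : (0 : ℝ) < t := ht
          rw [← ENNReal.ofReal_mul (hcos z), ← ENNReal.ofReal_mul (by positivity)]
          congr 1
          rw [show -(‖z‖ ^ 2 * t) = -t * ‖z‖ ^ 2 by ring]
          ring
  have hG' : ENNReal.ofReal (Real.Gamma s) ≠ 0 := by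
    rw [Ne, ENNReal.ofReal_eq_zero, not_le]; exact hG
  rw [← ENNReal.mul_right_inj hG' ENNReal.ofReal_ne_top,
    ← lintegral_const_mul' _ _ ENNReal.ofReal_ne_top]
  calc _ = ∫⁻ z : V, ∫⁻ t in Set.Ioi (0 : ℝ), ENNReal.ofReal (t ^ (s - 1)) *
        ENNReal.ofReal ((2 - 2 * Real.cos (2 * Real.pi * inner ℝ z w)) *
          Real.exp (-t * ‖z‖ ^ 2)) := lintegral_congr hpt
    _ = ∫⁻ t in Set.Ioi (0 : ℝ), ∫⁻ z : V, ENNReal.ofReal (t ^ (s - 1)) *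
        ENNReal.ofReal ((2 - 2 * Real.cos (2 * Real.pi * inner ℝ z w)) *
          Real.exp (-t * ‖z‖ ^ 2)) :=
        lintegral_lintegral_swap (Measurable.aemeasurable (by fun_prop))
    -- The Gaussian integral contributes (π/t)^{d/2}, and s - 1 - d/2 = -1/2 in every dimension.
    _ = ∫⁻ t in Set.Ioi (0 : ℝ), ENNReal.ofReal (2 * Real.pi ^ ((d : ℝ) / 2)) *
        ENNReal.ofReal (t ^ (-(1 / 2) : ℝ) * (1 - Real.exp (-(Real.pi ^ 2 * ‖w‖ ^ 2 / t)))) := by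
        refine setLIntegral_congr_fun measurableSet_Ioi fun t ht => ?_
        have ht' : (0 : ℝ) < t := ht
        rw [lintegral_const_mul' _ _ ENNReal.ofReal_ne_top, lintegral_one_sub_cos_mul_exp ht',
          ← ENNReal.ofReal_mul (by positivity), ← ENNReal.ofReal_mul (by positivity), ← hd,
          Real.div_rpow Real.pi_pos.le ht'.le]
        congr 1
        have : t ^ (-(1 / 2) : ℝ) = t ^ (s - 1) / t ^ ((d : ℝ) / 2) := by
          rw [← Real.rpow_sub ht']; congr 1; rw [hs]; ring
        rw [this]
        ring
    _ = _ := by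
        rw [lintegral_const_mul' _ _ ENNReal.ofReal_ne_top,
          lintegral_rpow_mul_one_sub_exp (by positivity), ← ENNReal.ofReal_mul (by positivity),
          ← ENNReal.ofReal_mul hG.le]
        congr 1
        rw [show ((d : ℝ) + 3) / 2 = d / 2 + 1 / 2 + 1 by ring, Real.rpow_add_one Real.pi_ne_zero,
          Real.rpow_add Real.pi_pos, ← Real.sqrt_eq_rpow, ← mul_pow,
          Real.sqrt_sq (by positivity)]
        field_simp
        ring

/-- With z = x - y the double integral is a weighted average over `z` of the squared L² norms of f(·
+ z) - f. Plancherel diagonalises each of them, and integrating over `z` first leaves the symbol, a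
multiple of ‖w‖. All integrands are nonnegative, so no finiteness is needed for the exchanges. -/
theorem lintegral_gagliardo_of_measurable {f : V → ℂ} (hfm : Measurable f) (hf : MemLp f 2) :
    ∫⁻ p : V × V, ENNReal.ofReal (‖f p.1 - f p.2‖ ^ 2 / ‖p.1 - p.2‖ ^ (Module.finrank ℝ V + 1))
      ∂(volume.prod volume) =
    ENNReal.ofReal (4 * Real.pi ^ (((Module.finrank ℝ V : ℝ) + 3) / 2) /
      Real.Gamma (((Module.finrank ℝ V : ℝ) + 1) / 2)) *
      ∫⁻ w, ENNReal.ofReal ‖w‖ * ‖(𝓕 (hf.toLp f) : Lp ℂ 2 (volume : Measure V)) w‖ₑ ^ 2 := by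
  set d := Module.finrank ℝ V with hd
  set F : Lp ℂ 2 (volume : Measure V) := 𝓕 (hf.toLp f) with hF
  have hFm : AEMeasurable F volume := (Lp.aestronglyMeasurable _).aemeasurable
  have hG : 0 < Real.Gamma (((d : ℝ) + 1) / 2) := Real.Gamma_pos_of_pos (by positivity)
  have hsplit : ∀ y z : V, ENNReal.ofReal (‖f (z + y) - f y‖ ^ 2 / ‖z‖ ^ (d + 1)) =
      ENNReal.ofReal (1 / ‖z‖ ^ (d + 1)) * ‖f (y + z) - f y‖ₑ ^ 2 := by
    intro y z
    rw [← ofReal_norm, ← ENNReal.ofReal_pow (norm_nonneg _), ← ENNReal.ofReal_mul (by positivity),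
      add_comm z y]
    congr 1
    ring
  calc _ = ∫⁻ y : V, ∫⁻ x : V, ENNReal.ofReal (‖f x - f y‖ ^ 2 / ‖x - y‖ ^ (d + 1)) :=
        lintegral_prod_symm _ (Measurable.aemeasurable (by fun_prop))
    _ = ∫⁻ y : V, ∫⁻ z : V, ENNReal.ofReal (1 / ‖z‖ ^ (d + 1)) * ‖f (y + z) - f y‖ₑ ^ 2 := by
        refine lintegral_congr fun y => ?_
        rw [← lintegral_add_right_eq_self _ y]
        refine lintegral_congr fun z => ?_
        rw [add_sub_cancel_right, hsplit]
    _ = ∫⁻ z : V, ∫⁻ y : V, ENNReal.ofReal (1 / ‖z‖ ^ (d + 1)) * ‖f (y + z) - f y‖ₑ ^ 2 :=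
        lintegral_lintegral_swap (Measurable.aemeasurable (by fun_prop))
    _ = ∫⁻ z : V, ∫⁻ w : V, ENNReal.ofReal ((2 - 2 * Real.cos (2 * Real.pi * inner ℝ z w)) /
        ‖z‖ ^ (d + 1)) * ‖F w‖ₑ ^ 2 := by
        refine lintegral_congr fun z => ?_
        rw [lintegral_const_mul' _ _ ENNReal.ofReal_ne_top, lintegral_enorm_translate_sub_sq hf,
          ← lintegral_const_mul' _ _ ENNReal.ofReal_ne_top]
        refine lintegral_congr fun w => ?_
        rw [← mul_assoc, ← ENNReal.ofReal_mul (by positivity), one_div_mul_eq_div]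
    _ = ∫⁻ w : V, ∫⁻ z : V, ENNReal.ofReal ((2 - 2 * Real.cos (2 * Real.pi * inner ℝ z w)) /
        ‖z‖ ^ (d + 1)) * ‖F w‖ₑ ^ 2 := by
        have hk : Measurable fun p : V × V => ENNReal.ofReal
            ((2 - 2 * Real.cos (2 * Real.pi * inner ℝ p.1 p.2)) / ‖p.1‖ ^ (d + 1)) := by fun_prop
        exact lintegral_lintegral_swap (hk.aemeasurable.mul
          ((hFm.comp_quasiMeasurePreserving
            Measure.quasiMeasurePreserving_snd).enorm.pow_const 2))
    _ = _ := by
        rw [← lintegral_const_mul' _ _ ENNReal.ofReal_ne_top]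
        refine lintegral_congr fun w => ?_
        rw [lintegral_mul_const' _ _ (ENNReal.pow_ne_top enorm_ne_top),
          lintegral_one_sub_cos_div_norm_pow, ← hd, ENNReal.ofReal_mul (by positivity), mul_assoc]

/-- The Gagliardo seminorm of order `1/2` in terms of the Fourier transform. -/
theorem lintegral_gagliardoIntegrand {d : ℕ} {f : EuclideanSpace ℝ (Fin d) → ℂ}
    (hf : MemLp f 2) :
    ∫⁻ p, ENNReal.ofReal (gagliardoIntegrand f p) ∂(volume.prod volume) =
    ENNReal.ofReal (4 * Real.pi ^ (((d : ℝ) + 3) / 2) / Real.Gamma (((d : ℝ) + 1) / 2)) *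
      ∫⁻ w, ENNReal.ofReal ‖w‖ * ‖(𝓕 (hf.toLp f) :
        Lp ℂ 2 (volume : Measure (EuclideanSpace ℝ (Fin d)))) w‖ₑ ^ 2 := by
  obtain ⟨g, hg, hfg⟩ := hf.aestronglyMeasurable
  have hg2 : MemLp g 2 := hf.ae_eq hfg
  have h := lintegral_gagliardo_of_measurable hg.measurable hg2
  rw [← MemLp.toLp_eq_toLp_iff hf hg2 |>.2 hfg] at h
  rw [finrank_euclideanSpace_fin] at h
  rw [← h]
  refine lintegral_congr_ae ?_
  filter_upwards [Measure.quasiMeasurePreserving_fst.ae hfg,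
    Measure.quasiMeasurePreserving_snd.ae hfg] with p hp1 hp2
  rw [gagliardoIntegrand, hp1, hp2]

end Gaussian

/-! ### Normalisation of the Bessel kernel and of its reference measure. -/

section Kernel

/-- The volume of a ball of radius `1/2`, the density of `besselMeasure`. -/
noncomputable def besselConst (d : ℕ) : ℝ :=
  Real.pi ^ ((d : ℝ) / 2) / (2 ^ d * Real.Gamma ((d : ℝ) / 2 + 1))

theorem besselConst_pos (d : ℕ) : 0 < besselConst d := by
  have : 0 < Real.Gamma ((d : ℝ) / 2 + 1) := Real.Gamma_pos_of_pos (by positivity)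
  unfold besselConst
  positivity

theorem besselMeasure_eq (d : ℕ) :
    besselMeasure d = ENNReal.ofReal (besselConst d) • volume := rfl

instance (d : ℕ) : SigmaFinite (besselMeasure d) := by
  have : (besselMeasure d) = (besselConst d).toNNReal • volume := rfl
  rw [this]; infer_instance

theorem volume_real_ball_eq_ballKernel {V : Type*} [NormedAddCommGroup V] [InnerProductSpace ℝ V]
    [FiniteDimensional ℝ V] [MeasurableSpace V] [BorelSpace V] (R : ℝ) :
    volume.real (Metric.ball (0 : V) R) = ballKernel R (0 : V) := by
  simp [ballKernel]

theorem abs_ballKernel_le {V : Type*} [NormedAddCommGroup V] [InnerProductSpace ℝ V]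
    [FiniteDimensional ℝ V] [MeasurableSpace V] [BorelSpace V] (R : ℝ) (z : V) :
    |ballKernel R z| ≤ volume.real (Metric.ball (0 : V) R) := by
  have := norm_setIntegral_le_of_norm_le_const (μ := volume) (s := Metric.ball (0 : V) R) (C := 1)
    (f := fun x => Real.cos (2 * Real.pi * inner ℝ z x)) measure_ball_lt_top
    (fun x _ => Real.abs_cos_le_one _)
  simpa [ballKernel] using this

theorem measurable_ballKernel {V : Type*} [NormedAddCommGroup V] [InnerProductSpace ℝ V]
    [FiniteDimensional ℝ V] [MeasurableSpace V] [BorelSpace V] (R : ℝ) :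
    Measurable (ballKernel (V := V) R) := by
  have h : StronglyMeasurable fun p : V × V => Real.cos (2 * Real.pi * inner ℝ p.1 p.2) :=
    Continuous.stronglyMeasurable (by fun_prop)
  exact (h.integral_prod_right' (ν := volume.restrict (Metric.ball (0 : V) R))).measurable

variable {n : ℕ} {L : ℝ}

theorem besselConst_mul_besselKernel (hL : 0 < L) (x y : EuclideanSpace ℝ (Fin (n + 1))) :
    besselConst (n + 1) * besselKernel (n + 1) L x y = ballKernel (L / 2) (x - y) :=
  (setIntegral_ball_cos (x - y) hL).symm

theorem besselConst_mul_pow (hL : 0 < L) : besselConst (n + 1) * L ^ (n + 1) =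
    volume.real (Metric.ball (0 : EuclideanSpace ℝ (Fin (n + 1))) (L / 2)) := by
  rw [volume_real_ball_eq_ballKernel, ← sub_self (0 : EuclideanSpace ℝ (Fin (n + 1))),
    ← besselConst_mul_besselKernel hL]
  simp [besselKernel, besselProfile]

theorem besselKernel_self (d : ℕ) (L : ℝ) (x : EuclideanSpace ℝ (Fin d)) :
    besselKernel d L x x = L ^ d := by
  simp [besselKernel, besselProfile]

theorem besselKernel_symm (d : ℕ) (L : ℝ) (x y : EuclideanSpace ℝ (Fin d)) :
    besselKernel d L x y = besselKernel d L y x := by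
  rw [besselKernel, besselKernel, norm_sub_rev]

/-- The Fourier integral of an indicator is at most the volume, its value at 0; no estimate on
Bessel functions is involved. -/
theorem abs_besselKernel_le (hL : 0 < L) (x y : EuclideanSpace ℝ (Fin (n + 1))) :
    |besselKernel (n + 1) L x y| ≤ L ^ (n + 1) := by
  have h := abs_ballKernel_le (L / 2) (x - y)
  rw [← besselConst_mul_besselKernel hL, ← besselConst_mul_pow hL, abs_mul,
    abs_of_pos (besselConst_pos _)] at h
  exact le_of_mul_le_mul_left h (besselConst_pos _)

theorem measurable_besselKernel (hL : 0 < L) :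
    Measurable fun p : EuclideanSpace ℝ (Fin (n + 1)) × EuclideanSpace ℝ (Fin (n + 1)) =>
      besselKernel (n + 1) L p.1 p.2 := by
  have h : (fun p : EuclideanSpace ℝ (Fin (n + 1)) × EuclideanSpace ℝ (Fin (n + 1)) =>
      besselKernel (n + 1) L p.1 p.2) =
      fun p => (besselConst (n + 1))⁻¹ * ballKernel (L / 2) (p.1 - p.2) := by
    funext p
    rw [← besselConst_mul_besselKernel hL, inv_mul_cancel_left₀ (besselConst_pos _).ne']
  rw [h]
  exact ((measurable_ballKernel (L / 2)).comp (measurable_fst.sub measurable_snd)).const_mul _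

end Kernel

section Measure

variable {d : ℕ} {f : EuclideanSpace ℝ (Fin d) → ℂ} {p : ENNReal}

theorem memLp_besselMeasure_iff : MemLp f p (besselMeasure d) ↔ MemLp f p volume := by
  have h0 : ENNReal.ofReal (besselConst d) ≠ 0 := by simpa using besselConst_pos d
  refine ⟨fun h => ?_, fun h => h.smul_measure ENNReal.ofReal_ne_top⟩
  have := h.smul_measure (c := (ENNReal.ofReal (besselConst d))⁻¹) (by simpa using h0)
  rwa [besselMeasure_eq, smul_smul, ENNReal.inv_mul_cancel h0 ENNReal.ofReal_ne_top,
    one_smul] at this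

theorem tendsto_eLpNorm_besselMeasure_iff {g : ℕ → EuclideanSpace ℝ (Fin d) → ℂ} :
    Tendsto (fun n => eLpNorm (g n - f) 2 (besselMeasure d)) atTop (𝓝 0) ↔
      Tendsto (fun n => eLpNorm (g n - f) 2 volume) atTop (𝓝 0) := by
  have h0 : ENNReal.ofReal (besselConst d) ≠ 0 := by simpa using besselConst_pos d
  set a := ENNReal.ofReal (besselConst d) ^ (1 / (2 : ENNReal)).toReal with ha
  have ha0 : a ≠ 0 := by rw [ha]; simp [h0]
  have hat : a ≠ ⊤ := by rw [ha]; simp [h0]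
  have he : ∀ n, eLpNorm (g n - f) 2 (besselMeasure d) = a * eLpNorm (g n - f) 2 volume :=
    fun n => by
      rw [besselMeasure_eq, eLpNorm_smul_measure_of_ne_zero h0, smul_eq_mul]
  simp only [he]
  refine ⟨fun h => ?_, fun h => ?_⟩
  · have := ENNReal.Tendsto.const_mul (a := a⁻¹) h (Or.inr (by simpa using ha0))
    simpa only [mul_zero, ← mul_assoc, ENNReal.inv_mul_cancel ha0 hat, one_mul] using this
  · simpa using ENNReal.Tendsto.const_mul (a := a) h (Or.inr hat)

theorem prod_besselMeasure (d : ℕ) : (besselMeasure d).prod (besselMeasure d) =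
    ENNReal.ofReal (besselConst d ^ 2) •
      (volume : Measure (EuclideanSpace ℝ (Fin d))).prod volume := by
  rw [besselMeasure_eq, Measure.prod_smul_left, Measure.prod_smul_right, smul_smul, sq,
    ENNReal.ofReal_mul (besselConst_pos d).le]

end Measure

/-! ### Linear statistics of the Bessel process and their L² extension. -/

section Statistic

open FourierTransform

variable {n : ℕ} {L : ℝ} {Ω : Type*} [MeasurableSpace Ω] {P : Measure Ω} [IsProbabilityMeasure P]
  {Ξ : Ω → Set (EuclideanSpace ℝ (Fin (n + 1)))} {f : EuclideanSpace ℝ (Fin (n + 1)) → ℂ}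

/-- The single integral in the variance carries one factor `besselConst` and the double integral
carries two, which is what turns `κ` into the volume of the ball and `K ^ 2` into `ballKernel ^ 2`.
The result is stated with the L² transform so that it survives limits in L². -/
theorem summable_and_memLp_and_variance_besselKernel (hL : 0 < L)
    (hΞ : IsDeterminantal P Ξ (besselKernel (n + 1) L) (besselMeasure (n + 1)))
    (h1 : Integrable f) (h2 : MemLp f 2) :
    (∀ᵐ ω ∂P, Summable fun x : Ξ ω => f x) ∧ MemLp (linearStatistic Ξ f) 2 P ∧
      ENNReal.ofReal (complexVariance P (linearStatistic Ξ f)) =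
        ∫⁻ w, volume (Metric.ball 0 (L / 2) \ Metric.ball w (L / 2)) *
          ‖(𝓕 (h2.toLp f) :
            Lp ℂ 2 (volume : Measure (EuclideanSpace ℝ (Fin (n + 1))))) w‖ₑ ^ 2 := by
  obtain ⟨hs, hm, hv⟩ := hΞ.summable_and_memLp_and_complexVariance (κ := L ^ (n + 1))
    (by positivity) (besselKernel_self _ L) (besselKernel_symm _ L) (abs_besselKernel_le hL)
    (measurable_besselKernel hL)
    (memLp_one_iff_integrable.1 (memLp_besselMeasure_iff.2 (memLp_one_iff_integrable.2 h1)))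
    (memLp_besselMeasure_iff.2 h2)
  refine ⟨hs, hm, ?_⟩
  have hc := (besselConst_pos (n + 1)).le
  have hv' : complexVariance P (linearStatistic Ξ f) = ∫ w, ‖𝓕 f w‖ ^ 2 *
      volume.real (Metric.ball (0 : EuclideanSpace ℝ (Fin (n + 1))) (L / 2) \
        Metric.ball w (L / 2)) := by
    rw [← Complex.ofReal_inj, hv, ← ballKernel_variance_eq h1 h2, ← besselConst_mul_pow hL,
      prod_besselMeasure, besselMeasure_eq, integral_smul_measure, integral_smul_measure,
      ENNReal.toReal_ofReal hc, ENNReal.toReal_ofReal (sq_nonneg _)]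
    simp only [← besselConst_mul_besselKernel hL, mul_pow, Complex.ofReal_mul, mul_assoc]
    rw [integral_const_mul]
    simp only [Complex.real_smul]
    push_cast
    ring
  have hF := fourier_toLp_ae_eq h1 h2
  have hV := measurable_volume_ball_diff_ball (V := EuclideanSpace ℝ (Fin (n + 1))) (L / 2)
  have hmeas : AEStronglyMeasurable fun w => ‖𝓕 f w‖ ^ 2 *
      volume.real (Metric.ball (0 : EuclideanSpace ℝ (Fin (n + 1))) (L / 2) \
        Metric.ball w (L / 2)) :=
    ((continuous_fourier_of_integrable h1).norm.pow 2).aestronglyMeasurable.mul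
      hV.ennreal_toReal.aestronglyMeasurable
  rw [hv', integral_eq_lintegral_of_nonneg_ae (Eventually.of_forall fun w => by positivity) hmeas]
  have hfin : ∀ w : EuclideanSpace ℝ (Fin (n + 1)),
      volume (Metric.ball 0 (L / 2) \ Metric.ball w (L / 2)) ≠ ⊤ := fun w =>
    ne_top_of_le_ne_top measure_ball_lt_top.ne (measure_mono Set.sdiff_subset)
  have heq : ∫⁻ w, ENNReal.ofReal (‖𝓕 f w‖ ^ 2 *
      volume.real (Metric.ball (0 : EuclideanSpace ℝ (Fin (n + 1))) (L / 2) \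
        Metric.ball w (L / 2))) = ∫⁻ w, volume (Metric.ball 0 (L / 2) \ Metric.ball w (L / 2)) *
          ‖(𝓕 (h2.toLp f) :
            Lp ℂ 2 (volume : Measure (EuclideanSpace ℝ (Fin (n + 1))))) w‖ₑ ^ 2 := by
    refine lintegral_congr_ae ?_
    filter_upwards [hF] with w hw
    rw [hw, ENNReal.ofReal_mul (sq_nonneg _), ENNReal.ofReal_pow (norm_nonneg _), ofReal_norm,
      measureReal_def, ENNReal.ofReal_toReal (hfin w), mul_comm]
  rw [heq, ENNReal.ofReal_toReal]
  refine ne_top_of_le_ne_top (b := ∫⁻ w,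
    volume (Metric.ball (0 : EuclideanSpace ℝ (Fin (n + 1))) (L / 2)) *
    ‖(𝓕 (h2.toLp f) : Lp ℂ 2 (volume : Measure (EuclideanSpace ℝ (Fin (n + 1))))) w‖ₑ ^ 2) ?_
    (lintegral_mono fun w => by gcongr; exact Set.sdiff_subset)
  rw [lintegral_const_mul' _ _ measure_ball_lt_top.ne, ← eLpNorm_two_sq_eq_lintegral]
  exact ENNReal.mul_ne_top measure_ball_lt_top.ne
    (ENNReal.pow_ne_top (Lp.memLp _).eLpNorm_ne_top)

end Statistic

section Variance

variable {Ω : Type*} [MeasurableSpace Ω] {P : Measure Ω} [IsProbabilityMeasure P] {Z : Ω → ℂ}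

theorem ofReal_complexVariance (hZ : MemLp Z 2 P) :
    ENNReal.ofReal (complexVariance P Z) = ∫⁻ ω, ‖Z ω - ∫ ω', Z ω' ∂P‖ₑ ^ 2 ∂P := by
  have hm : MemLp (fun ω => Z ω - ∫ ω', Z ω' ∂P) 2 P := hZ.sub (memLp_const _)
  rw [complexVariance, ofReal_integral_eq_lintegral_ofReal (hm.integrable_norm_pow two_ne_zero)
    (Eventually.of_forall fun ω => sq_nonneg _)]
  simp only [ENNReal.ofReal_pow (norm_nonneg _), ofReal_norm]

theorem integral_sub_integral (hZ : MemLp Z 2 P) : ∫ ω, (Z ω - ∫ ω', Z ω' ∂P) ∂P = 0 := by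
  rw [integral_sub (hZ.integrable one_le_two) (integrable_const _)]
  simp

end Variance

section Statistic

open FourierTransform

variable {n : ℕ} {L : ℝ} {Ω : Type*} [MeasurableSpace Ω] {P : Measure Ω} [IsProbabilityMeasure P]
  {Ξ : Ω → Set (EuclideanSpace ℝ (Fin (n + 1)))} {f g h : EuclideanSpace ℝ (Fin (n + 1)) → ℂ}

theorem memLp_centered (hL : 0 < L)
    (hΞ : IsDeterminantal P Ξ (besselKernel (n + 1) L) (besselMeasure (n + 1)))
    (h1 : Integrable f) (h2 : MemLp f 2) :
    MemLp (fun ω => linearStatistic Ξ f ω - ∫ ω', linearStatistic Ξ f ω' ∂P) 2 P :=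
  (summable_and_memLp_and_variance_besselKernel hL hΞ h1 h2).2.1.sub (memLp_const _)

/-- The weight |B \ (w + B)| is at most |B|. For fixed `L` this bounds the centring map from the L²
norm to L²(P), so it extends beyond integrable functions. -/
theorem eLpNorm_centered_sq_le (hL : 0 < L)
    (hΞ : IsDeterminantal P Ξ (besselKernel (n + 1) L) (besselMeasure (n + 1)))
    (h1 : Integrable f) (h2 : MemLp f 2) :
    eLpNorm (fun ω => linearStatistic Ξ f ω - ∫ ω', linearStatistic Ξ f ω' ∂P) 2 P ^ 2 ≤
      volume (Metric.ball (0 : EuclideanSpace ℝ (Fin (n + 1))) (L / 2)) *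
        eLpNorm f 2 volume ^ 2 := by
  obtain ⟨-, hm, hv⟩ := summable_and_memLp_and_variance_besselKernel hL hΞ h1 h2
  rw [eLpNorm_two_sq_eq_lintegral, ← ofReal_complexVariance hm, hv, eLpNorm_two_sq_eq_lintegral,
    ← lintegral_enorm_fourier_sq h1 h2, ← lintegral_const_mul' _ _ measure_ball_lt_top.ne]
  refine lintegral_mono_ae ?_
  filter_upwards [fourier_toLp_ae_eq h1 h2] with w hw
  rw [hw]
  gcongr
  exact Set.sdiff_subset

/-- The statistic is linear only where the sums converge, hence the almost sure summability. -/
theorem centered_sub_ae_eq (hL : 0 < L)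
    (hΞ : IsDeterminantal P Ξ (besselKernel (n + 1) L) (besselMeasure (n + 1)))
    (hg1 : Integrable g) (hg2 : MemLp g 2) (hh1 : Integrable h) (hh2 : MemLp h 2) :
    (fun ω => linearStatistic Ξ g ω - ∫ ω', linearStatistic Ξ g ω' ∂P) -
      (fun ω => linearStatistic Ξ h ω - ∫ ω', linearStatistic Ξ h ω' ∂P) =ᵐ[P]
      fun ω => linearStatistic Ξ (g - h) ω - ∫ ω', linearStatistic Ξ (g - h) ω' ∂P := by
  obtain ⟨hgs, hgm, -⟩ := summable_and_memLp_and_variance_besselKernel hL hΞ hg1 hg2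
  obtain ⟨hhs, hhm, -⟩ := summable_and_memLp_and_variance_besselKernel hL hΞ hh1 hh2
  have heq : linearStatistic Ξ (g - h) =ᵐ[P]
      fun ω => linearStatistic Ξ g ω - linearStatistic Ξ h ω := by
    filter_upwards [hgs, hhs] with ω h3 h4 using h3.tsum_sub h4
  have hint : ∫ ω, linearStatistic Ξ (g - h) ω ∂P =
      (∫ ω, linearStatistic Ξ g ω ∂P) - ∫ ω, linearStatistic Ξ h ω ∂P := by
    rw [integral_congr_ae heq, integral_sub (hgm.integrable one_le_two) (hhm.integrable one_le_two)]
  filter_upwards [heq] with ω hω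
  rw [hω, hint, Pi.sub_apply]
  ring

theorem dist_centered_le (hL : 0 < L)
    (hΞ : IsDeterminantal P Ξ (besselKernel (n + 1) L) (besselMeasure (n + 1)))
    (hg1 : Integrable g) (hg2 : MemLp g 2) (hh1 : Integrable h) (hh2 : MemLp h 2) :
    dist ((memLp_centered hL hΞ hg1 hg2).toLp _) ((memLp_centered hL hΞ hh1 hh2).toLp _) ≤
      √(volume.real (Metric.ball (0 : EuclideanSpace ℝ (Fin (n + 1))) (L / 2))) *
        dist (hg2.toLp g) (hh2.toLp h) := by
  rw [dist_eq_norm, dist_eq_norm, ← MemLp.toLp_sub, ← MemLp.toLp_sub, Lp.norm_toLp, Lp.norm_toLp,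
    eLpNorm_congr_ae (centered_sub_ae_eq hL hΞ hg1 hg2 hh1 hh2)]
  refine (abs_le_of_sq_le_sq' ?_ (by positivity)).2
  rw [mul_pow, Real.sq_sqrt measureReal_nonneg, measureReal_def, ← ENNReal.toReal_pow,
    ← ENNReal.toReal_pow, ← ENNReal.toReal_mul]
  exact ENNReal.toReal_mono
    (ENNReal.mul_ne_top measure_ball_lt_top.ne (ENNReal.pow_ne_top (hg2.sub hh2).eLpNorm_ne_top))
    (eLpNorm_centered_sq_le hL hΞ (hg1.sub hh1) (hg2.sub hh2))

/-- The Lipschitz bound makes the statistics of one approximating sequence Cauchy; comparing with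
it, the same bound shows that every other sequence has the same limit. -/
theorem exists_isCenteredLinearStatistic (hL : 0 < L)
    (hΞ : IsDeterminantal P Ξ (besselKernel (n + 1) L) (besselMeasure (n + 1)))
    (hf : MemLp f 2) :
    ∃ Y : Ω → ℂ, IsCenteredLinearStatistic P Ξ (besselMeasure (n + 1)) f Y := by
  obtain ⟨g, hg1, hg2, hgf⟩ := exists_tendsto_eLpNorm_sub hf
  have hg := (Lp.tendsto_Lp_iff_tendsto_eLpNorm'' g hg2 f hf).2 hgf
  set C := √(volume.real (Metric.ball (0 : EuclideanSpace ℝ (Fin (n + 1))) (L / 2)))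
  set u : ℕ → Lp ℂ 2 P := fun k => (memLp_centered hL hΞ (hg1 k) (hg2 k)).toLp _ with hu
  have hcau : CauchySeq u := by
    rw [cauchySeq_iff_tendsto_dist_atTop_0]
    refine squeeze_zero (fun _ => dist_nonneg)
      (fun k => dist_centered_le hL hΞ (hg1 k.1) (hg2 k.1) (hg1 k.2) (hg2 k.2)) ?_
    simpa using (cauchySeq_iff_tendsto_dist_atTop_0.1 hg.cauchySeq).const_mul C
  obtain ⟨Y, hY⟩ := cauchySeq_tendsto_of_complete hcau
  refine ⟨Y, Lp.memLp Y, fun h hh1 hh2 hhf => ?_⟩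
  have hh1' : ∀ k, Integrable (h k) := fun k =>
    memLp_one_iff_integrable.1 (memLp_besselMeasure_iff.1 (hh1 k))
  have hh2' : ∀ k, MemLp (h k) 2 := fun k => memLp_besselMeasure_iff.1 (hh2 k)
  have hhl := (Lp.tendsto_Lp_iff_tendsto_eLpNorm'' h hh2' f hf).2
    (tendsto_eLpNorm_besselMeasure_iff.1 hhf)
  refine (Lp.tendsto_Lp_iff_tendsto_eLpNorm'' _ (fun k => memLp_centered hL hΞ (hh1' k) (hh2' k))
    _ (Lp.memLp Y)).1 ?_
  rw [Lp.toLp_coeFn, tendsto_iff_dist_tendsto_zero]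
  have hlim : Tendsto (fun k => C * dist ((hh2' k).toLp (h k)) ((hg2 k).toLp (g k)) + dist (u k) Y)
      atTop (𝓝 0) := by
    simpa using ((hhl.dist hg).const_mul C).add (hY.dist (tendsto_const_nhds (x := Y)))
  exact squeeze_zero (fun _ => dist_nonneg) (fun k => (dist_triangle _ (u k) _).trans
    (by gcongr; exact dist_centered_le hL hΞ (hh1' k) (hh2' k) (hg1 k) (hg2 k))) hlim

/-- Both sides are continuous along an approximating sequence: the left because L² convergence
preserves second moments and the zero mean, the right because the weight is bounded. -/
theorem IsCenteredLinearStatistic.ofReal_complexVariance_besselKernel (hL : 0 < L)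
    (hΞ : IsDeterminantal P Ξ (besselKernel (n + 1) L) (besselMeasure (n + 1)))
    (hf : MemLp f 2) {Y : Ω → ℂ}
    (hY : IsCenteredLinearStatistic P Ξ (besselMeasure (n + 1)) f Y) :
    ENNReal.ofReal (complexVariance P Y) =
      ∫⁻ w, volume (Metric.ball 0 (L / 2) \ Metric.ball w (L / 2)) *
        ‖(𝓕 (hf.toLp f) : Lp ℂ 2 (volume : Measure (EuclideanSpace ℝ (Fin (n + 1))))) w‖ₑ ^ 2 := by
  obtain ⟨g, hg1, hg2, hgf⟩ := exists_tendsto_eLpNorm_sub hf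
  have hZ := fun k => memLp_centered hL hΞ (hg1 k) (hg2 k)
  have hlim := hY.tendsto g
    (fun k => memLp_besselMeasure_iff.2 (memLp_one_iff_integrable.2 (hg1 k)))
    (fun k => memLp_besselMeasure_iff.2 (hg2 k)) (tendsto_eLpNorm_besselMeasure_iff.2 hgf)
  have hmean : ∫ ω, Y ω ∂P = 0 := by
    have h1 := tendsto_integral_of_L1' Y hY.memLp.aestronglyMeasurable
      (Eventually.of_forall fun k => (hZ k).integrable one_le_two)
      (tendsto_of_tendsto_of_tendsto_of_le_of_le tendsto_const_nhds hlim (fun k => bot_le)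
        fun k => eLpNorm_le_eLpNorm_of_exponent_le one_le_two
          ((hZ k).sub hY.memLp).aestronglyMeasurable)
    refine tendsto_nhds_unique h1 (tendsto_const_nhds.congr fun k => ?_)
    exact (integral_sub_integral
      (summable_and_memLp_and_variance_besselKernel hL hΞ (hg1 k) (hg2 k)).2.1).symm
  rw [ofReal_complexVariance hY.memLp, hmean]
  simp only [sub_zero]
  refine tendsto_nhds_unique (tendsto_lintegral_sq_of_eLpNorm_sub hZ hY.memLp hlim) ?_
  refine (tendsto_lintegral_weight_mul_fourier hg2 hf hgf
    (measurable_volume_ball_diff_ball (L / 2)) measure_ball_lt_top.ne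
    (fun w => measure_mono Set.sdiff_subset)).congr fun k => ?_
  obtain ⟨-, hm, hv⟩ := summable_and_memLp_and_variance_besselKernel hL hΞ (hg1 k) (hg2 k)
  rw [← hv, ofReal_complexVariance hm]

end Statistic

/-! ### Identification of the constant and passage to the limit. -/

section Limit

open FourierTransform

variable {n : ℕ} {f : EuclideanSpace ℝ (Fin (n + 1)) → ℂ}

/-- The factor Γ(d/2+1)² cancels against the square of `besselConst`, and Γ((d+1)/2) = Γ(n/2+1) is
the one in the volume of the n-dimensional unit ball. -/
theorem limitVariance_eq (hf : MemHHalf f) :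
    ENNReal.ofReal (limitVariance (n + 1) f) =
      ENNReal.ofReal ((1 / 2) ^ n) * volume (Metric.ball (0 : EuclideanSpace ℝ (Fin n)) 1) *
        ∫⁻ w, ENNReal.ofReal ‖w‖ * ‖(𝓕 (hf.1.toLp f) :
          Lp ℂ 2 (volume : Measure (EuclideanSpace ℝ (Fin (n + 1))))) w‖ₑ ^ 2 := by
  have hnn : ∀ p, 0 ≤ gagliardoIntegrand f p := fun p => by unfold gagliardoIntegrand; positivity
  have hG1 : 0 < Real.Gamma ((n : ℝ) / 2 + 1) := Real.Gamma_pos_of_pos (by positivity)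
  have hG2 : 0 < Real.Gamma (((n + 1 : ℕ) : ℝ) / 2 + 1) := Real.Gamma_pos_of_pos (by positivity)
  rw [limitVariance, prod_besselMeasure, integral_smul_measure,
    ENNReal.toReal_ofReal (sq_nonneg _), smul_eq_mul, ← mul_assoc,
    ENNReal.ofReal_mul (by positivity),
    ofReal_integral_eq_lintegral_ofReal hf.2 (Eventually.of_forall hnn),
    lintegral_gagliardoIntegrand hf.1, ← mul_assoc, ← ENNReal.ofReal_mul (by positivity)]
  congr 1
  have hvol : volume (Metric.ball (0 : EuclideanSpace ℝ (Fin n)) 1) =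
      ENNReal.ofReal (Real.pi ^ ((n : ℝ) / 2) / Real.Gamma ((n : ℝ) / 2 + 1)) := by
    -- For `n = 0`, that is `d = 1`, the equatorial disc is a single point of mass 1 and is treated
    -- apart.
    rcases Nat.eq_zero_or_pos n with rfl | hn
    · have hu : Metric.ball (0 : EuclideanSpace ℝ (Fin 0)) 1 = Set.univ :=
        Set.eq_univ_of_forall fun x => by simp [Subsingleton.elim x 0]
      rw [hu, ← (PiLp.volume_preserving_toLp (Fin 0)).measure_preimage
        MeasurableSet.univ.nullMeasurableSet]
      simp [Measure.volume_pi_eq_dirac 0]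
    · have : Nonempty (Fin n) := Fin.pos_iff_nonempty.1 hn
      rw [EuclideanSpace.volume_ball, Real.sqrt_eq_rpow, ← Real.rpow_natCast,
        ← Real.rpow_mul Real.pi_pos.le, Fintype.card_fin, ENNReal.ofReal_one, one_pow, one_mul,
        one_div_mul_eq_div]
  rw [hvol, ← ENNReal.ofReal_mul (by positivity)]
  congr 1
  have e1 : Real.Gamma ((((n + 1 : ℕ) : ℝ) + 1) / 2) = Real.Gamma ((n : ℝ) / 2 + 1) := by
    congr 1; push_cast; ring
  have e2 : Real.pi ^ ((((n + 1 : ℕ) : ℝ) + 3) / 2) = Real.pi ^ ((n : ℝ) / 2) * Real.pi ^ 2 := by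
    rw [← Real.rpow_natCast, ← Real.rpow_add Real.pi_pos]
    congr 1; push_cast; ring
  have e3 : (Real.pi ^ (((n + 1 : ℕ) : ℝ) / 2)) ^ 2 = Real.pi ^ (n + 1) := by
    rw [← Real.rpow_natCast, ← Real.rpow_mul Real.pi_pos.le, ← Real.rpow_natCast]
    congr 1; push_cast; ring
  rw [besselConst, div_pow, e3, e1, e2, Nat.add_sub_cancel]
  have hπ := Real.pi_pos
  rw [div_pow, one_pow]
  field_simp
  ring

theorem tendsto_div_pow_limitVariance (hf : MemHHalf f) {v : ℝ → ℝ}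
    (hv0 : ∀ L, 0 ≤ v L)
    (hv : ∀ L, 0 < L → ENNReal.ofReal (v L) =
      ∫⁻ w, volume (Metric.ball 0 (L / 2) \ Metric.ball w (L / 2)) *
        ‖(𝓕 (hf.1.toLp f) : Lp ℂ 2 (volume : Measure (EuclideanSpace ℝ (Fin (n + 1))))) w‖ₑ ^ 2) :
    Tendsto (fun L => v L / L ^ n) atTop (𝓝 (limitVariance (n + 1) f)) := by
  set F : Lp ℂ 2 (volume : Measure (EuclideanSpace ℝ (Fin (n + 1)))) := 𝓕 (hf.1.toLp f) with hF
  have hFm : Measurable F := (Lp.stronglyMeasurable _).measurable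
  set κ := volume (Metric.ball (0 : EuclideanSpace ℝ (Fin n)) 1) with hκ
  have hlv0 : 0 ≤ limitVariance (n + 1) f := by
    unfold limitVariance
    refine mul_nonneg (by positivity) (integral_nonneg fun p => ?_)
    unfold gagliardoIntegrand; positivity
  -- The ball has radius `L / 2` while the normalisation is by `L ^ n`.
  set a := ENNReal.ofReal ((1 / 2) ^ n) with ha
  have hfun : ∀ L : ℝ, 0 < L → ENNReal.ofReal ((L ^ n)⁻¹) =
      a * ENNReal.ofReal (((L / 2) ^ n)⁻¹) := fun L hL => by
    rw [ha, ← ENNReal.ofReal_mul (by positivity)]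
    congr 1
    rw [div_pow, div_pow, one_pow]
    field_simp
  have hlim : ∫⁻ w, a * (ENNReal.ofReal ‖w‖ * κ) * ‖F w‖ₑ ^ 2 =
      ENNReal.ofReal (limitVariance (n + 1) f) := by
    rw [limitVariance_eq hf, ← lintegral_const_mul' _ _ (ENNReal.mul_ne_top ENNReal.ofReal_ne_top
      measure_ball_lt_top.ne)]
    refine lintegral_congr fun w => ?_
    ring
  have hmain : Tendsto (fun L : ℝ => ∫⁻ w, ENNReal.ofReal ((L ^ n)⁻¹) *
      volume (Metric.ball 0 (L / 2) \ Metric.ball w (L / 2)) * ‖F w‖ₑ ^ 2) atTop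
      (𝓝 (∫⁻ w, a * (ENNReal.ofReal ‖w‖ * κ) * ‖F w‖ₑ ^ 2)) := by
    -- The majorant is the limit itself, since the upper bound for the volume is attained
    -- asymptotically.
    refine tendsto_lintegral_filter_of_dominated_convergence
      (fun w => a * (ENNReal.ofReal ‖w‖ * κ) * ‖F w‖ₑ ^ 2)
      (Eventually.of_forall fun L => ?_) ?_ ?_ (Eventually.of_forall fun w => ?_)
    · exact ((measurable_volume_ball_diff_ball (L / 2)).const_mul _).mul
        (hFm.enorm.pow_const 2)
    · filter_upwards [eventually_gt_atTop 0] with L hL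
      refine Eventually.of_forall fun w => ?_
      gcongr ?_ * _
      rw [hfun L hL, mul_assoc]
      gcongr a * ?_
      calc _ ≤ ENNReal.ofReal (((L / 2) ^ n)⁻¹) * (ENNReal.ofReal ‖w‖ *
            volume (Metric.ball (0 : EuclideanSpace ℝ (Fin n)) (L / 2))) := by
            gcongr
            exact volume_ball_diff_ball_le (half_pos hL) w
        _ = ENNReal.ofReal ((((L / 2) ^ n)⁻¹) * (L / 2) ^ n) * (ENNReal.ofReal ‖w‖ * κ) := by
            rw [volume_ball_euclideanSpace_eq_pow (half_pos hL),
              ENNReal.ofReal_mul (by positivity)]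
            ring
        _ = _ := by rw [inv_mul_cancel₀ (by positivity), ENNReal.ofReal_one, one_mul]
    -- The majorant has finite integral because `hlim`, through `limitVariance_eq`, expresses it by
    -- the Gagliardo seminorm of `f`.
    · rw [hlim]
      exact ENNReal.ofReal_ne_top
    · refine ENNReal.Tendsto.mul_const ?_ (Or.inr (ENNReal.pow_ne_top enorm_ne_top))
      have h3 := ENNReal.Tendsto.const_mul (a := a) ((tendsto_volume_ball_diff_ball w).comp
        (tendsto_id.atTop_div_const (two_pos (α := ℝ)))) (Or.inr ENNReal.ofReal_ne_top)
      refine h3.congr' ?_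
      filter_upwards [eventually_gt_atTop 0] with L hL
      rw [hfun L hL]
      simp only [Function.comp_apply, id, mul_assoc]
  rw [hlim] at hmain
  have hreal := (ENNReal.tendsto_toReal ENNReal.ofReal_ne_top).comp hmain
  rw [ENNReal.toReal_ofReal hlv0] at hreal
  refine hreal.congr' ?_
  filter_upwards [eventually_gt_atTop 0] with L hL
  simp only [Function.comp_apply, mul_assoc]
  rw [lintegral_const_mul' _ _ ENNReal.ofReal_ne_top, ← hv L hL, ENNReal.toReal_mul,
    ENNReal.toReal_ofReal (hv0 L), ENNReal.toReal_ofReal (by positivity), div_eq_inv_mul]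

end Limit

end BesselDPP

/-! ### The theorem. -/

theorem mainTheorem9 (d : ℕ) (hd : 1 ≤ d)
    (f : EuclideanSpace ℝ (Fin d) → ℂ) (hf : BesselDPP.MemHHalf f)
    {Ω : ℝ → Type*} [∀ L, MeasurableSpace (Ω L)]
    (P : ∀ L, Measure (Ω L)) [∀ L, IsProbabilityMeasure (P L)]
    (Ξ : ∀ L, Ω L → Set (EuclideanSpace ℝ (Fin d)))
    (hΞ : ∀ L, 0 < L → BesselDPP.IsDeterminantal (P L) (Ξ L)
      (BesselDPP.besselKernel d L) (BesselDPP.besselMeasure d)) :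
    -- the centred linear statistic of `f` exists in `L²` ...
    (∀ L, 0 < L → ∃ Y : Ω L → ℂ, BesselDPP.IsCenteredLinearStatistic (P L) (Ξ L)
      (BesselDPP.besselMeasure d) f Y) ∧
    -- ... and its variance has the stated asymptotics;
    (∀ Y : ∀ L, Ω L → ℂ,
      (∀ L, 0 < L → BesselDPP.IsCenteredLinearStatistic (P L) (Ξ L)
        (BesselDPP.besselMeasure d) f (Y L)) →
      Tendsto (fun L : ℝ => BesselDPP.complexVariance (P L) (Y L) / L ^ (d - 1)) atTop
        (𝓝 (BesselDPP.limitVariance d f))) ∧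
    -- if `f` is integrable, the same holds for the absolutely convergent sum itself.
    (Integrable f volume →
      (∀ L, 0 < L → (∀ᵐ ω ∂(P L), Summable fun x : Ξ L ω => f x) ∧
        MemLp (BesselDPP.linearStatistic (Ξ L) f) 2 (P L)) ∧
      Tendsto (fun L : ℝ => BesselDPP.complexVariance (P L)
          (BesselDPP.linearStatistic (Ξ L) f) / L ^ (d - 1)) atTop
        (𝓝 (BesselDPP.limitVariance d f))) := by
  obtain ⟨n, rfl⟩ : ∃ n, d = n + 1 := ⟨d - 1, by omega⟩
  have hnonneg : ∀ L (Z : Ω L → ℂ), 0 ≤ BesselDPP.complexVariance (P L) Z := fun L Z =>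
    integral_nonneg fun ω => sq_nonneg _
  refine ⟨fun L hL => BesselDPP.exists_isCenteredLinearStatistic hL (hΞ L hL) hf.1,
    fun Y hY => ?_, fun h1 => ⟨fun L hL => ?_, ?_⟩⟩
  · exact BesselDPP.tendsto_div_pow_limitVariance hf (fun L => hnonneg L _) fun L hL =>
      (hY L hL).ofReal_complexVariance_besselKernel hL (hΞ L hL) hf.1
  · obtain ⟨h2, h3, -⟩ :=
      BesselDPP.summable_and_memLp_and_variance_besselKernel hL (hΞ L hL) h1 hf.1
    exact ⟨h2, h3⟩
  · exact BesselDPP.tendsto_div_pow_limitVariance hf (fun L => hnonneg L _) fun L hL =>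
      (BesselDPP.summable_and_memLp_and_variance_besselKernel hL (hΞ L hL) h1 hf.1).2.2
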